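/- Let $a>b>0$, $\alpha>-1$, $c=\sqrt{a^2-b^2}$, let $h(z)=(\operatorname{Re}z)^2/a^2+(\operatorname{Im}z)^2/b^2$, $E=\{z\in\mathbb{C}:h(z)<1\}$, and $dA_\alpha(z)=(1+\alpha)(1-h(z))^\alpha\,\frac{dx\,dy}{\pi ab}$ on $E$. With the Gegenbauer polynomials $C_n^{(1+\alpha)}$ put $$h_n=\frac{1+\alpha}{1+\alpha+n}\,C_n^{(1+\alpha)}\!\Big(\frac{a^2+b^2}{a^2-b^2}\Big),\qquad p_n(z)=\frac{1}{\sqrt{h_n}}\,C_n^{(1+\alpha)}\!\Big(\frac zc\Big),\qquad \kappa_N(z,\bar v)=\sum_{i=0}^{N-1}p_i(z)\overline{p_i(v)},$$ and for $v\in\mathbb{C}$ and $N\ge 0$ $$P_N(z)=\frac{\kappa_{N+1}(z,\bar v)\,p_{N+1}(v)-\kappa_{N+1}(v,\bar v)\,p_{N+1}(z)}{(v-z)\sqrt{\kappa_{N+1}(v,\bar v)\,\kappa_{N+2}(v,\bar v)}} .$$ For a measure $\nu$, the Bergman orthonormal polynomials of $\nu$ are the polynomials $Q_n$ of degree $n$,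 with positive leading coefficient, such that $\int Q_n\overline{Q_m}\,d\nu=\delta_{n,m}$. They satisfy a finite-term recurrence if there is a positive integer $d$ such that $\int zQ_n\overline{Q_l}\,d\nu=0$ whenever $0\le l<n+1-d$. 1. For every $v\in\mathbb{C}$, $(P_N)_{N\ge0}$ is the unique sequence of Bergman orthonormal polynomials of the measure $|v-z|^2\,dA_\alpha(z)$ on $E$, and $zP_n(z)=\sum_{l=0}^{n+1}c_{l,n}P_l(z)$ with the Fourier coefficients $c_{l,n}=c_{l,n}(v)=\int_E zP_n(z)\overline{P_l(z)}\,|v-z|^2\,dA_\alpha(z)$. 2. For all $0\le l\le n-2$ the coefficient $c_{l,n}$ is generically non-zero: $\{v\in\mathbb{C}:c_{l,n}(v)=0\}$ is a closed set of Lebesgue measure zero. Hence, for almost every $v\in\mathbb{C}$, $c_{l,n}(v)\neq0$ for all $0\le l\le n-2$ simultaneously. 3. For every $v\in\mathbb{C}$ with $v\neq\pm\frac{a^2+b^2}{\sqrt{a^2-b^2}}$, the polynomials $P_N$ satisfy no finite-term recurrence. 4. Consequently, on every non-circular ellipse the finite-term recurrence known for the flat weight (the setting of the Khavinson–Stylianopoulos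 theorem) can fail for a weighted area measure: there is a continuous weight $w>0$ on $E$, with all moments $\int_E z^k\bar z^l w(z)\,dx\,dy$ finite, whose Bergman orthonormal polynomials satisfy no finite-term recurrence. -/

import Mathlib

open MeasureTheory Polynomial
open scoped ComplexConjugate

noncomputable section

namespace WeightedEllipse

/-- `h(z) = (Re z)² / a² + (Im z)² / b²`. -/
def ellipseForm (a b : ℝ) (z : ℂ) : ℝ := z.re ^ 2 / a ^ 2 + z.im ^ 2 / b ^ 2

/-- The open interior `E` of the ellipse with half-axes `a`, `b`. -/
def ellipse (a b : ℝ) : Set ℂ := {z | ellipseForm a b z < 1}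

/-- The measure `w(z) d²z` on the domain `D`, with `d²z` the planar Lebesgue measure. -/
def weightedArea (D : Set ℂ) (w : ℂ → ℝ) : Measure ℂ :=
  (volume.restrict D).withDensity (fun z => ENNReal.ofReal (w z))

/-- The Lebesgue density `(1 + α) (1 - h(z))^α / (π a b)` of the measure `dA_α` on the ellipse. -/
def gegenbauerWeight (a b α : ℝ) (z : ℂ) : ℝ :=
  (1 + α) * (1 - ellipseForm a b z) ^ α / (Real.pi * a * b)

/-- The measure `|v - z|² dA_α(z)` on the ellipse. -/
def christoffelMeasure (a b α : ℝ) (v : ℂ) : Measure ℂ :=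
  weightedArea (ellipse a b) (fun z => ‖v - z‖ ^ 2 * gegenbauerWeight a b α z)

/-- `P` is the sequence of Bergman orthonormal polynomials of `ν`: `P n` has degree `n` and positive
leading coefficient, and `∫ P_n conj(P_m) dν = δ_{n,m}`. -/
structure IsBergmanSystem (ν : Measure ℂ) (P : ℕ → ℂ[X]) : Prop where
  natDegree_eq : ∀ n, (P n).natDegree = n
  leadingCoeff_pos : ∀ n, 0 < (P n).leadingCoeff.re ∧ (P n).leadingCoeff.im = 0
  integrable : ∀ n m, Integrable (fun z => (P n).eval z * conj ((P m).eval z)) ν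
  orthonormal : ∀ n m, ∫ z, (P n).eval z * conj ((P m).eval z) ∂ν = if n = m then 1 else 0

/-- The Fourier coefficient `c_{l,n} = ∫ z P_n(z) conj(P_l(z)) dν(z)`. -/
def fourierCoeff (ν : Measure ℂ) (P : ℕ → ℂ[X]) (l n : ℕ) : ℂ :=
  ∫ z, z * (P n).eval z * conj ((P l).eval z) ∂ν

/-- Finite `(d + 1)`-term recurrence for some positive `d`: the upper Hessenberg matrix `(c_{l,n})`
is banded, `c_{l,n} = 0` for `0 ≤ l < n + 1 - d`. -/
def HasFiniteTermRecurrence (ν : Measure ℂ) (P : ℕ → ℂ[X]) : Prop :=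
  ∃ d : ℕ, 0 < d ∧ ∀ l n : ℕ, l + d < n + 1 → fourierCoeff ν P l n = 0

/-- The Gegenbauer polynomials `C_n^{(lam)}`, through
`(n+2) C_{n+2} = 2 (n+1+lam) x C_{n+1} - (n+2 lam) C_n`. -/
def gegenbauer (lam : ℝ) : ℕ → ℝ[X]
  | 0 => 1
  | 1 => C (2 * lam) * X
  | n + 2 => C (2 * ((n : ℝ) + 1 + lam) / ((n : ℝ) + 2)) * X * gegenbauer lam (n + 1)
      - C (((n : ℝ) + 2 * lam) / ((n : ℝ) + 2)) * gegenbauer lam n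

/-- `h_n = (1+α)/(1+α+n) * C_n^{(1+α)}((a²+b²)/(a²-b²))`. -/
def gegenbauerNorm (a b α : ℝ) (n : ℕ) : ℝ :=
  (1 + α) / (1 + α + n) * (gegenbauer (1 + α) n).eval ((a ^ 2 + b ^ 2) / (a ^ 2 - b ^ 2))

/-- `p_n(z) = h_n^{-1/2} C_n^{(1+α)}(z / c)`, where `c = √(a² - b²)`. -/
def gegenbauerON (a b α : ℝ) (n : ℕ) : ℂ[X] :=
  C (((1 / √(gegenbauerNorm a b α n) : ℝ) : ℂ)) *
    ((gegenbauer (1 + α) n).map Complex.ofRealHom).comp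
      (C (((1 / √(a ^ 2 - b ^ 2) : ℝ) : ℂ)) * X)

/-- The kernel `κ_N(z, conj v) = ∑_{i<N} p_i(z) conj(p_i(v))` as a polynomial in `z`. -/
def kernelPoly (a b α : ℝ) (N : ℕ) (v : ℂ) : ℂ[X] :=
  ∑ i ∈ Finset.range N, C (conj ((gegenbauerON a b α i).eval v)) * gegenbauerON a b α i

/-- The value `κ_N(v, conj v) = ∑_{i<N} |p_i(v)|²` on the diagonal. -/
def kernelDiag (a b α : ℝ) (N : ℕ) (v : ℂ) : ℝ :=
  ∑ i ∈ Finset.range N, ‖(gegenbauerON a b α i).eval v‖ ^ 2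

/-- `κ_{N+1}(z, conj v) p_{N+1}(v) - κ_{N+1}(v, conj v) p_{N+1}(z)` as a polynomial in `z`. -/
def christoffelNumerator (a b α : ℝ) (v : ℂ) (N : ℕ) : ℂ[X] :=
  C ((gegenbauerON a b α (N + 1)).eval v) * kernelPoly a b α (N + 1) v
    - C ((kernelDiag a b α (N + 1) v : ℝ) : ℂ) * gegenbauerON a b α (N + 1)

/-- The polynomial
`P_N(z) = (κ_{N+1}(z, conj v) p_{N+1}(v) - κ_{N+1}(v, conj v) p_{N+1}(z))
  / ((v - z) √(κ_{N+1}(v, conj v) κ_{N+2}(v, conj v)))`.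
The numerator vanishes at `z = v`, so the quotient by `X - v` is exact
(see `sub_mul_christoffelPoly`). -/
def christoffelPoly (a b α : ℝ) (v : ℂ) (N : ℕ) : ℂ[X] :=
  C (((1 / √(kernelDiag a b α (N + 1) v * kernelDiag a b α (N + 2) v) : ℝ) : ℂ)) *
    -(christoffelNumerator a b α v N /ₘ (X - C v))

theorem christoffelNumerator_eval (a b α : ℝ) (v : ℂ) (N : ℕ) :
    (christoffelNumerator a b α v N).eval v = 0 := by
  have h : (kernelPoly a b α (N + 1) v).eval v = ((kernelDiag a b α (N + 1) v : ℝ) : ℂ) := by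
    simp only [kernelPoly, kernelDiag, eval_finsetSum, eval_mul, eval_C, Complex.ofReal_sum]
    refine Finset.sum_congr rfl fun i _ => ?_
    rw [mul_comm, Complex.mul_conj, Complex.normSq_eq_norm_sq]
  simp only [christoffelNumerator, eval_sub, eval_mul, eval_C, h]
  ring

theorem sub_mul_christoffelPoly (a b α : ℝ) (v : ℂ) (N : ℕ) :
    (C v - X) * christoffelPoly a b α v N =
      C (((1 / √(kernelDiag a b α (N + 1) v * kernelDiag a b α (N + 2) v) : ℝ) : ℂ)) *
        christoffelNumerator a b α v N := by
  have h := mul_divByMonic_eq_iff_isRoot.2 (christoffelNumerator_eval a b α v N)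
  rw [christoffelPoly]
  conv_rhs => rw [← h]
  ring

/-- The Fourier coefficients `c_{l,n}` of the polynomials `P_n` for the measure `|v - z|² dA_α`. -/
def christoffelCoeff (a b α : ℝ) (v : ℂ) (l n : ℕ) : ℂ :=
  fourierCoeff (christoffelMeasure a b α v) (christoffelPoly a b α v) l n

end WeightedEllipse

end

/-! Put `lam = 1 + α`, `A = (a + b) / 2`, `B = (a - b) / 2`. The map `ζ ↦ A ζ + B conj ζ` carries
the unit disc onto `E` and turns `dA_α` into a rotation invariant measure, for which `ζ^k conj(ζ)^l`
has nonzero integral only if `k = l`. The functions `(AB)^{n/2} C_n(z/c)` satisfy a recurrence whose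
coefficients are polynomial in `A`, `B`, so their integrals against `ζ^k conj(ζ)^l` are forms of
degree `n` in `A`, `B` with explicit coefficients (`diskIntegral_mul_monomial`). These vanish for `k
+ l < n`, which gives orthogonality; the case `k + l = n` gives the norms `h_n`.

The form of `|v - z|² dA_α` at `f`, `g` is that of `dA_α` at `(v - z) f`, `(v - z) g`. The numerator
of `P_N` vanishes at `v` and, by the reproducing property of the kernel, is orthogonal to every
polynomial of degree at most `N` vanishing at `v`. This gives part 1 (`form_christoffelNumerator`).

The `p_n` obey a three-term recurrence, so for `l + 2 ≤ n` the summand `z p_{n+1}` of `z` times the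
numerator of `P_n` is orthogonal to the numerator of `P_l`. Hence `c_{l,n}(v)` factors as a positive
number times `p_{n+1}(v)` times a defect `D_l(v, conj v)` independent of `n`
(`christoffelCoeff_eq`).

On each horizontal line `D_l` is a polynomial in `Re v`. Its coefficient of degree `3l + 2` is
nonzero by a reversed Turán inequality for Gegenbauer polynomials at `x = (a² + b²)/(a² - b²) > 1`
(`gegenbauer_turan`, `leadCoeffON_defect_ne_zero`). So every horizontal section of the zero set is
finite, and Fubini gives part 2.

Explicitly `D_0(z, w) = K (w² - (a² + b²)²/c²)` with `K ≠ 0`. Away from the two exceptional points,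
a finite-term recurrence would force `p_n(v) = 0` for all large `n`, whereas consecutive `p_n` have
no common zero. This gives part 3, and part 4 follows by choosing such a `v` outside `E`. -/

noncomputable section

namespace WeightedEllipse

/-! ### Moments of the radial weight on the disc -/

/-- The radial integral `∫₀¹ r^{2k+1} (1 - r²)^α dr`. -/
def radialMoment (α : ℝ) (k : ℕ) : ℝ := ∫ r in (0 : ℝ)..1, r ^ (2 * k + 1) * (1 - r ^ 2) ^ α

theorem hasDerivAt_radial (α : ℝ) (k : ℕ) {r : ℝ} (hr : r ∈ Set.Ioo (0 : ℝ) 1) :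
    HasDerivAt (fun r : ℝ => r ^ k * (1 - r ^ 2) ^ (α + 1))
      (k * r ^ (k - 1) * (1 - r ^ 2) ^ (α + 1) - 2 * (α + 1) * r ^ (k + 1) * (1 - r ^ 2) ^ α) r := by
  have h1 : 0 < 1 - r ^ 2 := by nlinarith [hr.1, hr.2]
  have h2 : HasDerivAt (fun r : ℝ => 1 - r ^ 2) (-(2 * r)) r := by
    simpa using (hasDerivAt_pow 2 r).const_sub 1
  have h3 := (hasDerivAt_pow k r).mul (h2.rpow_const (p := α + 1) (Or.inl h1.ne'))
  refine h3.congr_deriv ?_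
  rw [add_sub_cancel_right]
  ring

theorem continuous_radial {α : ℝ} (hα : -1 < α) (k : ℕ) :
    Continuous (fun r : ℝ => r ^ k * (1 - r ^ 2) ^ (α + 1)) := by
  refine (continuous_pow k).mul ?_
  exact (continuous_const.sub (continuous_pow 2)).rpow_const fun _ => Or.inr (by linarith)

/-- For `α < 0` the integrand is unbounded at `r = 1`. It is non-negative and has a primitive that
is continuous up to the endpoint because `α + 1 > 0`; this yields integrability and the value
together. -/
theorem radial_integrable_zero {α : ℝ} (hα : -1 < α) :
    IntervalIntegrable (fun r : ℝ => r * (1 - r ^ 2) ^ α) volume 0 1 ∧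
      ∫ r in (0 : ℝ)..1, r * (1 - r ^ 2) ^ α = 1 / (2 * (α + 1)) := by
  have hα' : α + 1 ≠ 0 := by linarith
  have hd : ∀ r ∈ Set.Ioo (0 : ℝ) 1,
      HasDerivAt (fun r : ℝ => -(1 / (2 * (α + 1))) * (r ^ 0 * (1 - r ^ 2) ^ (α + 1)))
        (r * (1 - r ^ 2) ^ α) r := by
    intro r hr
    refine ((hasDerivAt_radial α 0 hr).const_mul (-(1 / (2 * (α + 1))))).congr_deriv ?_
    field_simp
    simp
  have hc := ((continuous_radial hα 0).const_mul (-(1 / (2 * (α + 1)))))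
  have hi : IntervalIntegrable (fun r : ℝ => r * (1 - r ^ 2) ^ α) volume 0 1 := by
    rw [intervalIntegrable_iff_integrableOn_Ioc_of_le zero_le_one]
    refine intervalIntegral.integrableOn_deriv_of_nonneg hc.continuousOn hd fun r hr => ?_
    have : 0 < 1 - r ^ 2 := by nlinarith [hr.1, hr.2]
    have := hr.1
    positivity
  refine ⟨hi, ?_⟩
  rw [intervalIntegral.integral_eq_sub_of_hasDerivAt_of_le zero_le_one hc.continuousOn hd hi]
  simp [Real.zero_rpow hα']

theorem radial_integrable {α : ℝ} (hα : -1 < α) (k : ℕ) :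
    IntervalIntegrable (fun r : ℝ => r ^ (k + 1) * (1 - r ^ 2) ^ α) volume 0 1 := by
  have := (radial_integrable_zero hα).1.continuousOn_mul (continuous_pow k).continuousOn
  convert this using 2 with r
  ring

theorem radialMoment_zero {α : ℝ} (hα : -1 < α) : radialMoment α 0 = 1 / (2 * (α + 1)) := by
  simpa [radialMoment] using (radial_integrable_zero hα).2

/-- The function `r^{2k+2} (1 - r²)^{α+1}` vanishes at both endpoints, so its derivative integrates
to zero; splitting off one factor `1 - r²` leaves the two moments. -/
theorem radialMoment_succ {α : ℝ} (hα : -1 < α) (k : ℕ) :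
    (k + 1 + (1 + α)) * radialMoment α (k + 1) = (k + 1) * radialMoment α k := by
  have hα' : α + 1 ≠ 0 := by linarith
  have hi1 := (radial_integrable hα (2 * k)).const_mul (2 * k + 2 : ℝ)
  have hi2 := (radial_integrable hα (2 * k + 2)).const_mul (2 * (k + 1 + (1 + α)) : ℝ)
  have hd : ∀ r ∈ Set.Ioo (0 : ℝ) 1,
      HasDerivAt (fun r : ℝ => r ^ (2 * k + 2) * (1 - r ^ 2) ^ (α + 1))
        ((2 * k + 2) * (r ^ (2 * k + 1) * (1 - r ^ 2) ^ α)
          - 2 * (k + 1 + (1 + α)) * (r ^ (2 * k + 2 + 1) * (1 - r ^ 2) ^ α)) r := by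
    intro r hr
    have h1 : 0 < 1 - r ^ 2 := by nlinarith [hr.1, hr.2]
    refine (hasDerivAt_radial α (2 * k + 2) hr).congr_deriv ?_
    rw [Real.rpow_add_one h1.ne', show 2 * k + 2 - 1 = 2 * k + 1 by omega]
    push_cast
    ring
  have h := intervalIntegral.integral_eq_sub_of_hasDerivAt_of_le zero_le_one
    (continuous_radial hα (2 * k + 2)).continuousOn hd (hi1.sub hi2)
  rw [intervalIntegral.integral_sub hi1 hi2, intervalIntegral.integral_const_mul,
    intervalIntegral.integral_const_mul] at h
  simp only [one_pow, sub_self, Real.zero_rpow hα', mul_zero, ne_eq, Nat.add_eq_zero_iff,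
    OfNat.ofNat_ne_zero, and_false, not_false_eq_true, zero_pow, zero_mul] at h
  rw [radialMoment, radialMoment, show 2 * (k + 1) + 1 = 2 * k + 2 + 1 by ring]
  linarith

theorem integral_exp_int_mul (m : ℤ) :
    ∫ θ in (-Real.pi)..Real.pi, Complex.exp (m * Complex.I * θ) =
      if m = 0 then (2 * Real.pi : ℂ) else 0 := by
  split_ifs with h
  · subst h; simp; ring
  · have hm : (m : ℂ) * Complex.I ≠ 0 := mul_ne_zero (by exact_mod_cast h) Complex.I_ne_zero
    rw [integral_exp_mul_complex hm, div_eq_zero_iff]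
    left
    rw [sub_eq_zero, Complex.exp_eq_exp_iff_exists_int]
    exact ⟨m, by push_cast; ring⟩

/-- Polar coordinates separate the variables, and the angular integral of `exp(i(k-l)θ)` kills the
off-diagonal case. No integrability is used, so the computed value can later serve to prove
integrability. -/
theorem disk_moment {α : ℝ} (k l : ℕ) :
    ∫ ζ in Metric.ball (0 : ℂ) 1, ((1 - ‖ζ‖ ^ 2) ^ α : ℝ) • (ζ ^ k * conj ζ ^ l) =
      if k = l then ((2 * Real.pi * radialMoment α k : ℝ) : ℂ) else 0 := by
  rw [← integral_indicator Metric.isOpen_ball.measurableSet,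
    ← Complex.integral_comp_polarCoord_symm, polarCoord_target]
  have key : ∀ p ∈ Set.Ioi (0 : ℝ) ×ˢ Set.Ioo (-Real.pi) Real.pi,
      p.1 • (Metric.ball (0 : ℂ) 1).indicator
        (fun ζ : ℂ => ((1 - ‖ζ‖ ^ 2) ^ α : ℝ) • (ζ ^ k * conj ζ ^ l))
          (Complex.polarCoord.symm p) =
      (fun r : ℝ => (Set.Iio (1 : ℝ)).indicator
        (fun r : ℝ => ((r ^ (k + l + 1) * (1 - r ^ 2) ^ α : ℝ) : ℂ)) r) p.1 *
      (fun θ : ℝ => Complex.exp (((k : ℤ) - l : ℤ) * Complex.I * θ)) p.2 := by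
    rintro ⟨r, θ⟩ ⟨hr, -⟩
    simp only [Set.mem_Ioi] at hr
    have hz : Complex.polarCoord.symm (r, θ) = r * Complex.exp (θ * Complex.I) := by
      rw [Complex.polarCoord_symm_apply, Complex.exp_mul_I]
      simp
    have hn : ‖(r : ℂ) * Complex.exp (θ * Complex.I)‖ = r := by
      rw [norm_mul, Complex.norm_exp_ofReal_mul_I, mul_one, Complex.norm_real,
        Real.norm_of_nonneg hr.le]
    have he : ((r : ℂ) * Complex.exp (θ * Complex.I)) ^ k *
        conj ((r : ℂ) * Complex.exp (θ * Complex.I)) ^ l =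
        r ^ (k + l) * Complex.exp (((k : ℤ) - l : ℤ) * Complex.I * θ) := by
      rw [map_mul, Complex.conj_ofReal, ← Complex.exp_conj, map_mul, Complex.conj_ofReal,
        Complex.conj_I, mul_pow, mul_pow, ← Complex.exp_nat_mul, ← Complex.exp_nat_mul]
      rw [show ((((k : ℤ) - l : ℤ) : ℂ) * Complex.I * θ) =
        k * (θ * Complex.I) + l * (θ * -Complex.I) by push_cast; ring, Complex.exp_add]
      ring
    rw [hz]
    by_cases h1 : r < 1
    · rw [Set.indicator_of_mem (by rw [mem_ball_zero_iff, hn]; exact h1)]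
      beta_reduce
      rw [Set.indicator_of_mem (show r ∈ Set.Iio (1 : ℝ) from h1),
        hn, he]
      simp only [Complex.real_smul]
      push_cast
      ring
    · rw [Set.indicator_of_notMem (by rw [mem_ball_zero_iff, hn]; exact h1)]
      beta_reduce
      rw [Set.indicator_of_notMem (show r ∉ Set.Iio (1 : ℝ) from h1)]
      simp
  rw [setIntegral_congr_fun (measurableSet_Ioi.prod measurableSet_Ioo) key,
    Measure.volume_eq_prod,
    setIntegral_prod_mul (fun r : ℝ => (Set.Iio (1 : ℝ)).indicator
        (fun r : ℝ => ((r ^ (k + l + 1) * (1 - r ^ 2) ^ α : ℝ) : ℂ)) r)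
      (fun θ : ℝ => Complex.exp (((k : ℤ) - l : ℤ) * Complex.I * θ))]
  rw [← integral_Ioc_eq_integral_Ioo, ← intervalIntegral.integral_of_le (by linarith [Real.pi_pos]),
    integral_exp_int_mul]
  by_cases h : k = l
  · subst h
    rw [if_pos (by simp), if_pos rfl, setIntegral_indicator measurableSet_Iio, Set.Ioi_inter_Iio,
      ← integral_Ioc_eq_integral_Ioo, integral_complex_ofReal,
      ← intervalIntegral.integral_of_le zero_le_one, radialMoment, ← two_mul]
    push_cast
    ring
  · rw [if_neg (by omega), if_neg h, mul_zero]

/-! ### Integration against weighted area measures -/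

theorem integral_weightedArea {D : Set ℂ} (hD : MeasurableSet D) {w : ℂ → ℝ} (hw : Measurable w)
    (hw0 : ∀ z ∈ D, 0 ≤ w z) (F : ℂ → ℂ) :
    ∫ z, F z ∂weightedArea D w = ∫ z in D, w z • F z := by
  rw [weightedArea, integral_withDensity_eq_integral_toReal_smul hw.ennreal_ofReal
    (Filter.Eventually.of_forall fun _ => ENNReal.ofReal_lt_top)]
  refine setIntegral_congr_fun hD fun z hz => ?_
  simp only [ENNReal.toReal_ofReal (hw0 z hz)]

theorem integrable_weightedArea_iff {D : Set ℂ} (hD : MeasurableSet D) {w : ℂ → ℝ}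
    (hw : Measurable w) (hw0 : ∀ z ∈ D, 0 ≤ w z) (F : ℂ → ℂ) :
    Integrable F (weightedArea D w) ↔ IntegrableOn (fun z => w z • F z) D := by
  rw [weightedArea, integrable_withDensity_iff_integrable_smul₀' hw.ennreal_ofReal.aemeasurable
    (Filter.Eventually.of_forall fun _ => ENNReal.ofReal_lt_top), IntegrableOn]
  refine integrable_congr ?_
  filter_upwards [ae_restrict_mem hD] with z hz
  simp only [ENNReal.toReal_ofReal (hw0 z hz)]

theorem integrableOn_mul_continuous {D K : Set ℂ} (hK : IsCompact K) (hDK : D ⊆ K)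
    (hD : MeasurableSet D) {w : ℂ → ℝ} (hw : IntegrableOn w D) {F : ℂ → ℂ} (hF : Continuous F) :
    IntegrableOn (fun z => w z • F z) D := by
  obtain ⟨M, hM⟩ := hK.exists_bound_of_continuousOn hF.continuousOn
  refine Integrable.mono' (hw.norm.mul_const M)
    (hw.aestronglyMeasurable.smul hF.aestronglyMeasurable) ?_
  filter_upwards [ae_restrict_mem hD] with z hz
  rw [norm_smul]
  exact mul_le_mul_of_nonneg_left (hM z (hDK hz)) (norm_nonneg _)

/-! ### The ellipse as a linear image of the disc -/

/-- The linear map `ζ ↦ a Re ζ + i b Im ζ` from the unit disc onto the ellipse. -/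
def diskToEllipse (a b : ℝ) : ℂ →ₗ[ℝ] ℂ :=
  Matrix.toLin Complex.basisOneI Complex.basisOneI !![a, 0; 0, b]

theorem diskToEllipse_apply (a b : ℝ) (ζ : ℂ) : diskToEllipse a b ζ = ⟨a * ζ.re, b * ζ.im⟩ := by
  simp [diskToEllipse, Matrix.toLin_apply, Complex.ext_iff, Matrix.mulVec, dotProduct]

theorem det_diskToEllipse (a b : ℝ) : LinearMap.det (diskToEllipse a b) = a * b := by
  rw [diskToEllipse, LinearMap.det_toLin, Matrix.det_fin_two_of]
  ring

theorem diskToEllipse_eq (a b : ℝ) (ζ : ℂ) :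
    diskToEllipse a b ζ = ((a + b) / 2 : ℝ) * ζ + ((a - b) / 2 : ℝ) * conj ζ := by
  rw [diskToEllipse_apply]
  apply Complex.ext <;> simp <;> ring

theorem ellipseForm_diskToEllipse {a b : ℝ} (ha : a ≠ 0) (hb : b ≠ 0) (ζ : ℂ) :
    ellipseForm a b (diskToEllipse a b ζ) = ‖ζ‖ ^ 2 := by
  rw [diskToEllipse_apply, ellipseForm, ← Complex.normSq_eq_norm_sq, Complex.normSq_apply]
  field_simp

theorem continuous_ellipseForm (a b : ℝ) : Continuous (ellipseForm a b) := by
  unfold ellipseForm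
  exact ((Complex.continuous_re.pow 2).div_const _).add ((Complex.continuous_im.pow 2).div_const _)

theorem isOpen_ellipse (a b : ℝ) : IsOpen (ellipse a b) :=
  isOpen_lt (continuous_ellipseForm a b) continuous_const

theorem ellipse_subset_closedBall {a b : ℝ} (hb : 0 < b) (hab : b < a) :
    ellipse a b ⊆ Metric.closedBall 0 a := by
  intro z hz
  have ha : 0 < a := hb.trans hab
  rw [mem_closedBall_zero_iff, ← abs_of_pos ha, ← sq_le_sq₀ (norm_nonneg _) (abs_nonneg _), sq_abs,
    ← Complex.normSq_eq_norm_sq, Complex.normSq_apply]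
  have hz' : z.re ^ 2 / a ^ 2 + z.im ^ 2 / b ^ 2 < 1 := hz
  have h1 : z.im ^ 2 / a ^ 2 ≤ z.im ^ 2 / b ^ 2 := by gcongr
  have h2 : (z.re ^ 2 + z.im ^ 2) / a ^ 2 < 1 := by rw [add_div]; linarith
  rw [div_lt_one (by positivity)] at h2
  nlinarith

theorem setIntegral_ellipse {a b : ℝ} (ha : 0 < a) (hb : 0 < b) (F : ℂ → ℂ) :
    ∫ z in ellipse a b, F z =
      (a * b) • ∫ ζ in Metric.ball (0 : ℂ) 1, F (diskToEllipse a b ζ) := by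
  have hdet : LinearMap.det (diskToEllipse a b) ≠ 0 := by
    rw [det_diskToEllipse]; positivity
  have himg : (diskToEllipse a b) '' Metric.ball 0 1 = ellipse a b := by
    ext z
    constructor
    · rintro ⟨ζ, hζ, rfl⟩
      rw [mem_ball_zero_iff] at hζ
      change ellipseForm a b _ < 1
      rw [ellipseForm_diskToEllipse ha.ne' hb.ne']
      exact pow_lt_one₀ (norm_nonneg _) hζ two_ne_zero
    · intro hz
      have hz' : diskToEllipse a b ⟨z.re / a, z.im / b⟩ = z := by
        rw [diskToEllipse_apply]
        apply Complex.ext <;> field_simp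
      refine ⟨⟨z.re / a, z.im / b⟩, ?_, hz'⟩
      change ellipseForm a b z < 1 at hz
      rw [← hz', ellipseForm_diskToEllipse ha.ne' hb.ne'] at hz
      rw [mem_ball_zero_iff]
      exact (pow_lt_one_iff_of_nonneg (norm_nonneg _) two_ne_zero).1 hz
  have hinj : Set.InjOn (diskToEllipse a b) (Metric.ball 0 1) :=
    ((LinearMap.equivOfDetNeZero _ hdet).injective).injOn
  have hd : ∀ x ∈ Metric.ball (0 : ℂ) 1, HasFDerivWithinAt (diskToEllipse a b)
      (diskToEllipse a b).toContinuousLinearMap (Metric.ball 0 1) x := fun x _ =>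
    ((diskToEllipse a b).toContinuousLinearMap.hasFDerivAt).hasFDerivWithinAt
  rw [← himg, integral_image_eq_integral_abs_det_fderiv_smul volume
    Metric.isOpen_ball.measurableSet hd hinj, LinearMap.det_toContinuousLinearMap,
    det_diskToEllipse, abs_of_pos (by positivity), integral_smul]

/-! ### The Gegenbauer area measure -/

theorem measurable_gegenbauerWeight (a b α : ℝ) : Measurable (gegenbauerWeight a b α) := by
  unfold gegenbauerWeight
  have := (continuous_ellipseForm a b).measurable
  fun_prop

theorem gegenbauerWeight_pos {a b α : ℝ} (ha : 0 < a) (hb : 0 < b) (hα : -1 < α) {z : ℂ}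
    (hz : z ∈ ellipse a b) : 0 < gegenbauerWeight a b α z := by
  have h1 : 0 < 1 - ellipseForm a b z := sub_pos.2 hz
  have h2 : 0 < 1 + α := by linarith
  unfold gegenbauerWeight
  positivity

theorem setIntegral_gegenbauerWeight {a b α : ℝ} (ha : 0 < a) (hb : 0 < b) (F : ℂ → ℂ) :
    ∫ z in ellipse a b, gegenbauerWeight a b α z • F z =
      ∫ ζ in Metric.ball (0 : ℂ) 1,
        ((1 + α) / Real.pi * (1 - ‖ζ‖ ^ 2) ^ α) • F (diskToEllipse a b ζ) := by
  rw [setIntegral_ellipse ha hb, ← integral_smul]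
  refine setIntegral_congr_fun Metric.isOpen_ball.measurableSet fun ζ _ => ?_
  simp only [gegenbauerWeight, ellipseForm_diskToEllipse ha.ne' hb.ne', smul_smul]
  congr 1
  field_simp

/-- The moments `∫ |ζ|^{2k}` of the probability measure `(1 + α) (1 - |ζ|²)^α / π` on the disc. -/
def diskMoment (α : ℝ) (k : ℕ) : ℝ := 2 * (1 + α) * radialMoment α k

theorem diskMoment_zero {α : ℝ} (hα : -1 < α) : diskMoment α 0 = 1 := by
  have : α + 1 ≠ 0 := by linarith
  rw [diskMoment, radialMoment_zero hα]
  field_simp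
  ring

theorem diskMoment_succ {α : ℝ} (hα : -1 < α) (k : ℕ) :
    (k + 1 + (1 + α)) * diskMoment α (k + 1) = (k + 1) * diskMoment α k := by
  have := radialMoment_succ hα k
  unfold diskMoment
  linear_combination 2 * (1 + α) * this

theorem integral_disk_monomial {α : ℝ} (k l : ℕ) :
    ∫ ζ in Metric.ball (0 : ℂ) 1,
      ((1 + α) / Real.pi * (1 - ‖ζ‖ ^ 2) ^ α) • (ζ ^ k * conj ζ ^ l) =
      if k = l then (diskMoment α k : ℂ) else 0 := by
  have h := disk_moment (α := α) k l
  simp_rw [mul_smul]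
  rw [integral_smul, h]
  split_ifs
  · rw [diskMoment, Complex.real_smul]
    have := Complex.ofReal_ne_zero.2 Real.pi_ne_zero
    push_cast
    field_simp
  · simp

theorem integrableOn_diskWeight {α : ℝ} (hα : -1 < α) :
    IntegrableOn (fun ζ : ℂ => (1 + α) / Real.pi * (1 - ‖ζ‖ ^ 2) ^ α) (Metric.ball (0 : ℂ) 1) := by
  have h := integral_disk_monomial (α := α) 0 0
  simp only [pow_zero, mul_one, if_true, diskMoment_zero hα] at h
  have h2 : IntegrableOn (fun ζ : ℂ => ((1 + α) / Real.pi * (1 - ‖ζ‖ ^ 2) ^ α) • (1 : ℂ))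
      (Metric.ball (0 : ℂ) 1) := by
    -- A non-integrable function has integral `0` by convention, while this integral equals `1`.
    refine Integrable.of_integral_ne_zero ?_
    rw [h]
    simp
  simpa [IntegrableOn] using h2.re

theorem integrableOn_disk {α : ℝ} (hα : -1 < α) {F : ℂ → ℂ} (hF : Continuous F) :
    IntegrableOn (fun ζ : ℂ => ((1 + α) / Real.pi * (1 - ‖ζ‖ ^ 2) ^ α) • F ζ)
      (Metric.ball (0 : ℂ) 1) :=
  integrableOn_mul_continuous (isCompact_closedBall 0 1) Metric.ball_subset_closedBall
    Metric.isOpen_ball.measurableSet (integrableOn_diskWeight hα) hF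

theorem integrableOn_gegenbauerWeight {a b α : ℝ} (ha : 0 < a) (hb : 0 < b) (hα : -1 < α) :
    IntegrableOn (gegenbauerWeight a b α) (ellipse a b) := by
  have h := integral_disk_monomial (α := α) 0 0
  simp only [pow_zero, mul_one, if_true, diskMoment_zero hα] at h
  have h1 := setIntegral_gegenbauerWeight (α := α) ha hb (fun _ => 1)
  have h2 : IntegrableOn (fun z : ℂ => gegenbauerWeight a b α z • (1 : ℂ)) (ellipse a b) := by
    refine Integrable.of_integral_ne_zero ?_
    rw [h1, h]
    simp
  simpa [IntegrableOn] using h2.re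

/-- The integral of `F` against the probability measure `(1 + α) (1 - |ζ|²)^α / π` on the disc. -/
def diskIntegral (α : ℝ) (F : ℂ → ℂ) : ℂ :=
  ∫ ζ in Metric.ball (0 : ℂ) 1, ((1 + α) / Real.pi * (1 - ‖ζ‖ ^ 2) ^ α) • F ζ

theorem diskIntegral_monomial (α : ℝ) (k l : ℕ) :
    diskIntegral α (fun ζ => ζ ^ k * conj ζ ^ l) = if k = l then (diskMoment α k : ℂ) else 0 :=
  integral_disk_monomial k l

theorem diskIntegral_add {α : ℝ} (hα : -1 < α) {F G : ℂ → ℂ} (hF : Continuous F)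
    (hG : Continuous G) :
    diskIntegral α (fun ζ => F ζ + G ζ) = diskIntegral α F + diskIntegral α G := by
  unfold diskIntegral
  simp_rw [smul_add]
  exact integral_add (integrableOn_disk hα hF) (integrableOn_disk hα hG)

theorem diskIntegral_const_mul (α : ℝ) (c : ℂ) (F : ℂ → ℂ) :
    diskIntegral α (fun ζ => c * F ζ) = c * diskIntegral α F := by
  unfold diskIntegral
  rw [← integral_const_mul]
  simp_rw [mul_smul_comm]

theorem diskIntegral_sum {α : ℝ} (hα : -1 < α) {ι : Type*} (s : Finset ι) {F : ι → ℂ → ℂ}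
    (hF : ∀ i ∈ s, Continuous (F i)) :
    diskIntegral α (fun ζ => ∑ i ∈ s, F i ζ) = ∑ i ∈ s, diskIntegral α (F i) := by
  unfold diskIntegral
  simp_rw [Finset.smul_sum]
  exact integral_finsetSum _ fun i hi => integrableOn_disk hα (hF i hi)

/-! ### Homogeneous sums over the antidiagonal -/

/-- The homogeneous form `∑_{i+j=n} A^i B^j f(i,j)`. -/
def homogSum (A B : ℝ) (n : ℕ) (f : ℕ → ℕ → ℝ) : ℝ :=
  ∑ p ∈ Finset.HasAntidiagonal.antidiagonal n, A ^ p.1 * B ^ p.2 * f p.1 p.2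

theorem homogSum_zero (A B : ℝ) (f : ℕ → ℕ → ℝ) : homogSum A B 0 f = f 0 0 := by
  simp [homogSum]

theorem homogSum_one (A B : ℝ) (f : ℕ → ℕ → ℝ) :
    homogSum A B 1 f = A * f 1 0 + B * f 0 1 := by
  simp [homogSum, Finset.Nat.sum_antidiagonal_succ, add_comm]

/-- A three-term relation between the coefficients gives one between the homogeneous sums. -/
theorem homogSum_recurrence (A B N r t : ℝ) (n : ℕ) {f g₁ g₂ h : ℕ → ℕ → ℝ}
    (h0 : N * f 0 (n + 2) = r * g₂ 0 (n + 1)) (h1 : N * f (n + 2) 0 = r * g₁ (n + 1) 0)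
    (h2 : ∀ i j, i + j = n →
      N * f (i + 1) (j + 1) = r * (g₁ i (j + 1) + g₂ (i + 1) j) - t * h i j) :
    N * homogSum A B (n + 2) f =
      r * (A * homogSum A B (n + 1) g₁ + B * homogSum A B (n + 1) g₂)
        - t * (A * B) * homogSum A B n h := by
  unfold homogSum
  -- Both end terms are split off the sum of `f`, and the terms `i = n + 1` of `g₁` and `j = n + 1`
  -- of `g₂` off theirs. The interior sums then match by `h2`, the pure powers of `B` and `A` by
  -- `h0` and `h1`.
  rw [Finset.Nat.sum_antidiagonal_succ, Finset.Nat.sum_antidiagonal_succ',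
    Finset.Nat.sum_antidiagonal_succ' (f := fun p => A ^ p.1 * B ^ p.2 * g₁ p.1 p.2),
    Finset.Nat.sum_antidiagonal_succ (f := fun p => A ^ p.1 * B ^ p.2 * g₂ p.1 p.2)]
  have key : N * ∑ p ∈ Finset.HasAntidiagonal.antidiagonal n,
      A ^ (p.1 + 1) * B ^ (p.2 + 1) * f (p.1 + 1) (p.2 + 1) =
      r * (A * ∑ p ∈ Finset.HasAntidiagonal.antidiagonal n, A ^ p.1 * B ^ (p.2 + 1) * g₁ p.1 (p.2 + 1)
        + B * ∑ p ∈ Finset.HasAntidiagonal.antidiagonal n, A ^ (p.1 + 1) * B ^ p.2 * g₂ (p.1 + 1) p.2)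
        - t * (A * B) * ∑ p ∈ Finset.HasAntidiagonal.antidiagonal n, A ^ p.1 * B ^ p.2 * h p.1 p.2 := by
    simp only [Finset.mul_sum, ← Finset.sum_add_distrib, ← Finset.sum_sub_distrib]
    refine Finset.sum_congr rfl fun p hp => ?_
    linear_combination A ^ (p.1 + 1) * B ^ (p.2 + 1) * h2 p.1 p.2 (Finset.HasAntidiagonal.mem_antidiagonal.1 hp)
  linear_combination key + B ^ (n + 2) * h0 + A ^ (n + 2) * h1

/-! ### The projections of monomials on Gegenbauer polynomials -/

/-- The rising factorial `(lam)_n`. -/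
def rising (lam : ℝ) (n : ℕ) : ℝ := (ascPochhammer ℝ n).eval lam

theorem rising_zero (lam : ℝ) : rising lam 0 = 1 := by simp [rising]

theorem rising_succ (lam : ℝ) (n : ℕ) : rising lam (n + 1) = rising lam n * (lam + n) :=
  ascPochhammer_succ_eval n lam

theorem rising_one (lam : ℝ) : rising lam 1 = lam := by simp [rising]

theorem rising_pos {lam : ℝ} (h : 0 < lam) (n : ℕ) : 0 < rising lam n := ascPochhammer_pos n lam h

/-- The coefficient of `A^i B^j` in `∫ K_{i+j} ζ^k conj(ζ)^l`. -/
def diskCoeff (lam : ℝ) (i j k l : ℕ) : ℝ :=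
  if k + i = l + j then
    lam * rising lam i * rising lam j / j.factorial * l.choose i * k.factorial
      / rising lam (i + k + 1)
  else 0

/-- This and the two analogous lemmas below are the Gegenbauer recurrence read off coefficientwise:
the factor `A ζ` raises `i` and `k`, the factor `B conj ζ` raises `j` and `l`. The three cases are
the hypotheses of `homogSum_recurrence`. -/
theorem diskCoeff_zero_succ {lam : ℝ} (hl : 0 < lam) (m k l : ℕ) :
    (m + 1) * diskCoeff lam 0 (m + 1) k l = (m + lam) * diskCoeff lam 0 m k (l + 1) := by
  unfold diskCoeff
  by_cases h : k + 0 = l + (m + 1)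
  · rw [if_pos h, if_pos (by omega)]
    have := (rising_pos hl (0 + k + 1)).ne'
    have := Nat.factorial_ne_zero m
    rw [rising_succ, Nat.factorial_succ]
    push_cast
    simp only [Nat.choose_zero_right, Nat.cast_one]
    field_simp
    ring
  · rw [if_neg h, if_neg (by omega), mul_zero, mul_zero]

/-- The subtraction is the real one; for `i > l` both binomial coefficients vanish, so no case
distinction is needed later. -/
theorem choose_succ_mul_cast (l i : ℕ) :
    ((i : ℝ) + 1) * l.choose (i + 1) = ((l : ℝ) - i) * l.choose i := by
  rcases le_or_gt i l with h | h
  · have := Nat.choose_succ_right_eq l i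
    rw [← Nat.cast_sub h]
    exact_mod_cast (by linarith : (i + 1) * l.choose (i + 1) = (l - i) * l.choose i)
  · simp [Nat.choose_eq_zero_of_lt h, Nat.choose_eq_zero_of_lt (h.trans (Nat.lt_succ_self i))]

theorem diskCoeff_succ_zero {lam : ℝ} (hl : 0 < lam) (m k l : ℕ) :
    (m + 1) * diskCoeff lam (m + 1) 0 k l = (m + lam) * diskCoeff lam m 0 (k + 1) l := by
  unfold diskCoeff
  by_cases h : k + (m + 1) = l + 0
  · rw [if_pos h, if_pos (by omega), show m + 1 + k + 1 = m + (k + 1) + 1 by ring]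
    have := (rising_pos hl (m + (k + 1) + 1)).ne'
    have h3 := choose_succ_mul_cast l m
    have h4 : (l : ℝ) = k + m + 1 := by exact_mod_cast (by omega : l = k + m + 1)
    have h5 : ((m : ℝ) + 1) * l.choose (m + 1) = ((k : ℝ) + 1) * l.choose m := by
      rw [h3, h4]; ring
    rw [rising_succ lam m, Nat.factorial_succ k]
    push_cast
    field_simp
    linear_combination (rising lam m * rising lam 0 * (lam + m)) * h5
  · rw [if_neg h, if_neg (by omega), mul_zero, mul_zero]

theorem diskCoeff_succ_succ {lam : ℝ} (hl : 0 < lam) (i j k l : ℕ) :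
    (i + j + 2) * diskCoeff lam (i + 1) (j + 1) k l =
      (i + j + 1 + lam) * (diskCoeff lam i (j + 1) (k + 1) l + diskCoeff lam (i + 1) j k (l + 1))
        - (i + j + 2 * lam) * diskCoeff lam i j k l := by
  unfold diskCoeff
  by_cases h : k + i = l + j
  · rw [if_pos (by omega), if_pos (by omega), if_pos (by omega), if_pos h,
      show i + (k + 1) + 1 = (i + k + 1) + 1 by ring, show i + 1 + k + 1 = (i + k + 1) + 1 by ring,
      Nat.choose_succ_succ, rising_succ lam (i + k + 1), rising_succ lam i, rising_succ lam j,
      Nat.factorial_succ, Nat.factorial_succ]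
    have hQ := (rising_pos hl (i + k + 1)).ne'
    have hj : (j.factorial : ℝ) ≠ 0 := by exact_mod_cast Nat.factorial_ne_zero j
    have h4 : (l : ℝ) = k + i - j := by
      have : (k : ℝ) + i = l + j := by exact_mod_cast h
      linarith
    have hi : (i : ℝ) + 1 ≠ 0 := by positivity
    have hj1 : (j : ℝ) + 1 ≠ 0 := by positivity
    -- The support condition `k + i = l + j` turns `l - i` into `k - j`. With every factor expressed
    -- through `l.choose i`, the claim becomes a rational identity.
    have h5 : (l.choose (i + 1) : ℝ) = (k - j) * l.choose i / (i + 1) := by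
      rw [eq_div_iff hi, mul_comm, choose_succ_mul_cast, h4]; ring
    have h6 : lam + ((i : ℝ) + k + 1) ≠ 0 := by positivity
    push_cast
    rw [h5]
    field_simp
    ring
  · rw [if_neg (by omega), if_neg (by omega), if_neg (by omega), if_neg h]
    ring

theorem diskMoment_eq {α : ℝ} (hα : -1 < α) (k : ℕ) :
    diskMoment α k = (1 + α) * k.factorial / rising (1 + α) (k + 1) := by
  have hl : 0 < 1 + α := by linarith
  induction k with
  | zero => rw [diskMoment_zero hα, rising_one]; field_simp; simp
  | succ k ih =>
    have h := diskMoment_succ hα k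
    have h2 : (k : ℝ) + 1 + (1 + α) ≠ 0 := by positivity
    have h3 := (rising_pos hl (k + 1)).ne'
    rw [rising_succ, Nat.factorial_succ, ← mul_right_inj' h2, h, ih]
    push_cast
    have h4 : 1 + α + ((k : ℝ) + 1) ≠ 0 := by positivity
    field_simp
    ring

/-- The integrals of the homogenised Gegenbauer polynomials in `A ζ + B conj ζ` against the
monomials in `ζ`, `conj ζ`. -/
theorem diskIntegral_mul_monomial {α A B : ℝ} (hα : -1 < α) {F : ℕ → ℂ → ℂ}
    (hF : ∀ n, Continuous (F n)) (h0 : ∀ ζ, F 0 ζ = 1)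
    (h1 : ∀ ζ, F 1 ζ = (1 + α : ℝ) * (A * ζ + B * conj ζ))
    (h2 : ∀ (n : ℕ) ζ, (n + 2 : ℝ) * F (n + 2) ζ =
      (n + 1 + (1 + α) : ℝ) * ((A * ζ + B * conj ζ) * F (n + 1) ζ)
        - (n + 2 * (1 + α) : ℝ) * ((A * B : ℝ) * F n ζ)) (n : ℕ) :
    ∀ k l, diskIntegral α (fun ζ => F n ζ * (ζ ^ k * conj ζ ^ l)) =
      (homogSum A B n (fun i j => diskCoeff (1 + α) i j k l) : ℝ) := by
  have hl : 0 < 1 + α := by linarith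
  have hc : Continuous (conj : ℂ → ℂ) := Complex.continuous_conj
  -- The exponents `k`, `l` stay quantified, since the recurrence raises them.
  induction n using Nat.twoStepInduction with
  | zero =>
    intro k l
    simp_rw [h0, one_mul]
    rw [diskIntegral_monomial, homogSum_zero, diskCoeff]
    by_cases h : k = l
    · subst h
      rw [if_pos rfl, if_pos rfl, diskMoment_eq hα]
      simp [rising_zero]
    · rw [if_neg h, if_neg (by omega), Complex.ofReal_zero]
  | one =>
    intro k l
    have e : (fun ζ : ℂ => F 1 ζ * (ζ ^ k * conj ζ ^ l)) = fun ζ =>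
        ((1 + α : ℝ) * A : ℂ) * (ζ ^ (k + 1) * conj ζ ^ l)
          + ((1 + α : ℝ) * B : ℂ) * (ζ ^ k * conj ζ ^ (l + 1)) := by
      funext ζ; rw [h1]; ring
    rw [e, diskIntegral_add hα (by fun_prop) (by fun_prop), diskIntegral_const_mul,
      diskIntegral_const_mul, diskIntegral_monomial, diskIntegral_monomial, homogSum_one]
    have e1 : diskCoeff (1 + α) 1 0 k l = (1 + α) * if k + 1 = l then diskMoment α (k + 1) else 0 := by
      have := diskCoeff_succ_zero hl 0 k l
      simp only [Nat.cast_zero, zero_add, one_mul] at this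
      rw [this, diskCoeff, diskMoment_eq hα]
      simp [rising_zero]
    have e2 : diskCoeff (1 + α) 0 1 k l = (1 + α) * if k = l + 1 then diskMoment α k else 0 := by
      have := diskCoeff_zero_succ hl 0 k l
      simp only [Nat.cast_zero, zero_add, one_mul] at this
      rw [this, diskCoeff, diskMoment_eq hα]
      simp [rising_zero]
    rw [e1, e2]
    push_cast
    simp only [apply_ite Complex.ofReal, Complex.ofReal_zero]
    ring
  | more n ih ih1 =>
    intro k l
    have hn : ((n + 2 : ℝ) : ℂ) ≠ 0 := Complex.ofReal_ne_zero.2 (by positivity)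
    have e : (fun ζ : ℂ => ((n + 2 : ℝ) : ℂ) * (F (n + 2) ζ * (ζ ^ k * conj ζ ^ l))) = fun ζ =>
        ((((n + 1 + (1 + α) : ℝ) : ℂ) * A) * (F (n + 1) ζ * (ζ ^ (k + 1) * conj ζ ^ l))
          + (((n + 1 + (1 + α) : ℝ) : ℂ) * B) * (F (n + 1) ζ * (ζ ^ k * conj ζ ^ (l + 1))))
          + (-(((n + 2 * (1 + α) : ℝ) : ℂ) * (A * B : ℝ))) * (F n ζ * (ζ ^ k * conj ζ ^ l)) := by
      funext ζ; linear_combination (ζ ^ k * conj ζ ^ l) * h2 n ζ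
    have hc0 := hF n
    have hc1 := hF (n + 1)
    rw [← mul_right_inj' hn, ← diskIntegral_const_mul, e,
      diskIntegral_add hα (by fun_prop) (by fun_prop),
      diskIntegral_add hα (by fun_prop) (by fun_prop), diskIntegral_const_mul,
      diskIntegral_const_mul, diskIntegral_const_mul, ih, ih1, ih1]
    have key := homogSum_recurrence A B (n + 2) (n + 1 + (1 + α)) (n + 2 * (1 + α)) n
      (f := fun i j => diskCoeff (1 + α) i j k l) (g₁ := fun i j => diskCoeff (1 + α) i j (k + 1) l)
      (g₂ := fun i j => diskCoeff (1 + α) i j k (l + 1))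
      (h := fun i j => diskCoeff (1 + α) i j k l)
      (by have := diskCoeff_zero_succ hl (n + 1) k l; push_cast at this; linarith)
      (by have := diskCoeff_succ_zero hl (n + 1) k l; push_cast at this; linarith)
      (fun i j hij => by
        have := diskCoeff_succ_succ hl i j k l
        have h3 : (n : ℝ) = i + j := by exact_mod_cast hij.symm
        rw [h3]; linarith)
    rw [← Complex.ofReal_mul ((n : ℝ) + 2), key]
    push_cast
    ring

/-- On the support `k + i = l + j`, an index `i ≤ l` would force `j ≤ k`, hence `n = i + j ≤ k + l`.
So `i > l`, and the binomial coefficient vanishes. -/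
theorem homogSum_diskCoeff_eq_zero {lam A B : ℝ} {n k l : ℕ} (h : k + l < n) :
    homogSum A B n (fun i j => diskCoeff lam i j k l) = 0 := by
  refine Finset.sum_eq_zero fun p hp => ?_
  have hp' := Finset.HasAntidiagonal.mem_antidiagonal.1 hp
  beta_reduce
  rw [diskCoeff]
  split_ifs with h1
  · rw [Nat.choose_eq_zero_of_lt (by omega)]
    simp
  · simp

/-- The equations `k + i = l + j` and `i + j = l + k` leave only the term `(i, j) = (l, k)`. -/
theorem homogSum_diskCoeff_top {lam A B : ℝ} (k l : ℕ) :
    homogSum A B (l + k) (fun i j => diskCoeff lam i j k l) =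
      A ^ l * B ^ k * (lam * rising lam l * rising lam k / rising lam (l + k + 1)) := by
  rw [homogSum, Finset.sum_eq_single (l, k)]
  · have : (k.factorial : ℝ) ≠ 0 := by exact_mod_cast Nat.factorial_ne_zero k
    simp only [diskCoeff, Nat.choose_self, Nat.cast_one]
    rw [if_pos (by simp [add_comm])]
    field_simp
  · rintro ⟨i, j⟩ hp hne
    have hp' := Finset.HasAntidiagonal.mem_antidiagonal.1 hp
    simp only at hp'
    simp only [diskCoeff]
    rw [if_neg, mul_zero]
    intro h
    exact hne (by ext <;> simp only <;> omega)
  · simp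

/-! ### Gegenbauer polynomials -/

theorem gegenbauer_recurrence (lam : ℝ) (n : ℕ) (x : ℝ) :
    (n + 2) * (gegenbauer lam (n + 2)).eval x =
      2 * (n + 1 + lam) * x * (gegenbauer lam (n + 1)).eval x
        - (n + 2 * lam) * (gegenbauer lam n).eval x := by
  have : (n : ℝ) + 2 ≠ 0 := by positivity
  rw [gegenbauer]
  simp only [eval_sub, eval_mul, eval_C, eval_X]
  field_simp

theorem gegenbauer_degree {lam : ℝ} (hl : 0 < lam) (n : ℕ) :
    (gegenbauer lam n).natDegree = n ∧
      (gegenbauer lam n).coeff n = 2 ^ n * rising lam n / n.factorial := by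
  have main : (gegenbauer lam n).natDegree ≤ n ∧
      (gegenbauer lam n).coeff n = 2 ^ n * rising lam n / n.factorial := by
    induction n using Nat.twoStepInduction with
    | zero => simp [gegenbauer, rising_zero]
    | one => exact ⟨by rw [gegenbauer]; compute_degree, by simp [gegenbauer, rising_one]⟩
    | more n ih ih1 =>
      constructor
      · rw [gegenbauer]
        refine (natDegree_sub_le _ _).trans (max_le ?_ ?_)
        · refine natDegree_mul_le.trans ?_
          have h1 : (C (2 * ((n : ℝ) + 1 + lam) / ((n : ℝ) + 2)) * X).natDegree ≤ 1 := by
            compute_degree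
          have := ih1.1
          omega
        · exact (natDegree_C_mul_le _ _).trans (ih.1.trans (by omega))
      · rw [gegenbauer, coeff_sub, mul_assoc, coeff_C_mul, coeff_X_mul, coeff_C_mul, ih1.2,
          coeff_eq_zero_of_natDegree_lt (ih.1.trans_lt (by omega)), rising_succ lam (n + 1),
          Nat.factorial_succ (n + 1)]
        have := Nat.factorial_ne_zero (n + 1)
        have h3 : (n : ℝ) + 2 ≠ 0 := by positivity
        have h4 : (n : ℝ) + 1 + 1 ≠ 0 := by positivity
        push_cast
        field_simp
        ring
  refine ⟨natDegree_eq_of_le_of_coeff_ne_zero main.1 ?_, main.2⟩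
  rw [main.2]
  have := rising_pos hl n
  positivity

/-- The coefficients `(lam)_i (lam)_j / (i! j!)` of `C_{i+j}^{(lam)}` in exponential form. -/
def expCoeff (lam : ℝ) (i j : ℕ) : ℝ :=
  rising lam i / i.factorial * (rising lam j / j.factorial)

theorem rising_div_factorial_succ (lam : ℝ) (i : ℕ) :
    (i + 1) * (rising lam (i + 1) / (i + 1).factorial) =
      (lam + i) * (rising lam i / i.factorial) := by
  have := Nat.factorial_ne_zero i
  rw [rising_succ, Nat.factorial_succ]
  push_cast
  field_simp

/-- With `2x = A/B + B/A` the generating function `(1 - 2xt + t²)^{-lam}` splits as `(1 -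
tA/B)^{-lam} (1 - tB/A)^{-lam}`, whose coefficients are these sums. The proof checks that both sides
satisfy the same recurrence. -/
theorem gegenbauer_eval_eq_homogSum {lam A B x : ℝ} (h : 2 * (A * B) * x = A ^ 2 + B ^ 2) (n : ℕ) :
    (A * B) ^ n * (gegenbauer lam n).eval x = homogSum (A ^ 2) (B ^ 2) n (expCoeff lam) := by
  induction n using Nat.twoStepInduction with
  | zero => simp [gegenbauer, homogSum_zero, expCoeff, rising_zero]
  | one =>
    simp [gegenbauer, homogSum_one, expCoeff, rising_one, rising_zero]
    linear_combination lam * h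
  | more n ih ih1 =>
    have hn : (n : ℝ) + 2 ≠ 0 := by positivity
    have h1 := gegenbauer_recurrence lam n x
    have u := rising_div_factorial_succ lam
    have key := homogSum_recurrence (A ^ 2) (B ^ 2) (n + 2) (n + 1 + lam) (n + 2 * lam) n
      (f := expCoeff lam) (g₁ := expCoeff lam) (g₂ := expCoeff lam) (h := expCoeff lam)
      (by
        have := u (n + 1)
        push_cast at this
        unfold expCoeff
        linear_combination (rising lam 0 / (Nat.factorial 0 : ℕ)) * this)
      (by
        have := u (n + 1)
        push_cast at this
        unfold expCoeff
        linear_combination (rising lam 0 / (Nat.factorial 0 : ℕ)) * this)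
      (fun i j hij => by
        have h3 : (n : ℝ) = i + j := by exact_mod_cast hij.symm
        have hi := u i
        have hj := u j
        unfold expCoeff
        rw [h3]
        generalize rising lam (i + 1) / ((i + 1).factorial : ℝ) = ui1 at *
        generalize rising lam (j + 1) / ((j + 1).factorial : ℝ) = uj1 at *
        generalize rising lam i / (i.factorial : ℝ) = ui at *
        generalize rising lam j / (j.factorial : ℝ) = uj at *
        linear_combination (uj1 - uj) * hi + (ui1 - ui) * hj)
    rw [← mul_right_inj' hn, key, ← ih, ← ih1]
    linear_combination (A * B) ^ (n + 2) * h1 +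
      (n + 1 + lam) * (A * B) ^ (n + 1) * (gegenbauer lam (n + 1)).eval x * h

theorem gegenbauer_eval_pos {lam A B x : ℝ} (hl : 0 < lam) (hA : 0 < A) (hB : 0 < B)
    (h : 2 * (A * B) * x = A ^ 2 + B ^ 2) (n : ℕ) : 0 < (gegenbauer lam n).eval x := by
  have h1 : 0 < homogSum (A ^ 2) (B ^ 2) n (expCoeff lam) := by
    refine Finset.sum_pos (fun p _ => ?_) ⟨(0, n), by simp⟩
    have := rising_pos hl p.1
    have := rising_pos hl p.2
    unfold expCoeff
    positivity
  rw [← gegenbauer_eval_eq_homogSum h] at h1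
  exact (pos_iff_pos_of_mul_pos h1).1 (by positivity)

/-! ### Rescaled Gegenbauer polynomials -/

/-- The polynomial `C_n^{(lam)}(s z)`. -/
def scaledGegenbauer (lam s : ℝ) (n : ℕ) : ℂ[X] :=
  ((gegenbauer lam n).map Complex.ofRealHom).comp (C (s : ℂ) * X)

theorem scaledGegenbauer_zero (lam s : ℝ) : scaledGegenbauer lam s 0 = 1 := by
  simp [scaledGegenbauer, gegenbauer]

theorem scaledGegenbauer_one (lam s : ℝ) :
    scaledGegenbauer lam s 1 = C ((2 * lam * s : ℝ) : ℂ) * X := by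
  simp [scaledGegenbauer, gegenbauer, mul_assoc]

theorem scaledGegenbauer_recurrence (lam s : ℝ) (n : ℕ) :
    C ((n + 2 : ℝ) : ℂ) * scaledGegenbauer lam s (n + 2) =
      C ((2 * (n + 1 + lam) * s : ℝ) : ℂ) * (X * scaledGegenbauer lam s (n + 1))
        - C ((n + 2 * lam : ℝ) : ℂ) * scaledGegenbauer lam s n := by
  have h : C (n + 2 : ℝ) * gegenbauer lam (n + 2) =
      C (2 * (n + 1 + lam)) * (X * gegenbauer lam (n + 1)) - C (n + 2 * lam) * gegenbauer lam n := by
    refine Polynomial.funext fun x => ?_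
    simp only [eval_sub, eval_mul, eval_C, eval_X]
    linear_combination gegenbauer_recurrence lam n x
  have h2 := congrArg (fun p : ℝ[X] => (p.map Complex.ofRealHom).comp (C (s : ℂ) * X)) h
  simp only [Polynomial.map_mul, Polynomial.map_sub, Polynomial.map_C, Polynomial.map_X, mul_comp,
    sub_comp, C_comp, X_comp, Complex.ofRealHom_eq_coe] at h2
  unfold scaledGegenbauer
  rw [h2, Complex.ofReal_mul _ s, C_mul]
  ring

theorem scaledGegenbauer_degree {lam s : ℝ} (hl : 0 < lam) (hs : s ≠ 0) (n : ℕ) :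
    (scaledGegenbauer lam s n).natDegree = n ∧
      (scaledGegenbauer lam s n).coeff n =
        ((2 ^ n * rising lam n / n.factorial * s ^ n : ℝ) : ℂ) := by
  have hs' : (s : ℂ) ≠ 0 := Complex.ofReal_ne_zero.2 hs
  obtain ⟨h1, h2⟩ := gegenbauer_degree hl n
  constructor
  · rw [scaledGegenbauer, natDegree_comp, natDegree_map, h1, natDegree_C_mul_X _ hs', mul_one]
  · rw [scaledGegenbauer, comp_C_mul_X_coeff, coeff_map, h2]
    simp

theorem conj_scaledGegenbauer_eval (lam s : ℝ) (n : ℕ) (z : ℂ) :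
    conj ((scaledGegenbauer lam s n).eval z) = (scaledGegenbauer lam s n).eval (conj z) := by
  have h : (scaledGegenbauer lam s n).map (starRingEnd ℂ) = scaledGegenbauer lam s n := by
    rw [scaledGegenbauer, map_comp, Polynomial.map_map]
    congr 1
    · congr 1
      ext x
      simp
    · simp
  conv_rhs => rw [← h, eval_map, eval₂_at_apply]

/-! ### Orthogonality of the Gegenbauer polynomials on the ellipse -/

/-- The value of `∫ K_n conj(z)^n`. -/
def topMoment (lam A B : ℝ) (n : ℕ) : ℝ :=
  lam * n.factorial / rising lam (n + 1) * homogSum (A ^ 2) (B ^ 2) n (expCoeff lam)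

/-- Here `A conj ζ + B ζ` is the conjugate of the point of the ellipse. Its `m`-th power expands
into monomials of total degree `m`, so everything vanishes for `m < n`; for `m = n` only the top
coefficients enter, and they assemble to the same sum as `C_n` at the ellipse parameter. -/
theorem diskIntegral_mul_conj_pow {α A B : ℝ} (hα : -1 < α) {F : ℕ → ℂ → ℂ}
    (hF : ∀ n, Continuous (F n)) (h0 : ∀ ζ, F 0 ζ = 1)
    (h1 : ∀ ζ, F 1 ζ = (1 + α : ℝ) * (A * ζ + B * conj ζ))
    (h2 : ∀ (n : ℕ) ζ, (n + 2 : ℝ) * F (n + 2) ζ =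
      (n + 1 + (1 + α) : ℝ) * ((A * ζ + B * conj ζ) * F (n + 1) ζ)
        - (n + 2 * (1 + α) : ℝ) * ((A * B : ℝ) * F n ζ)) {n m : ℕ} (hm : m ≤ n) :
    diskIntegral α (fun ζ => F n ζ * (A * conj ζ + B * ζ) ^ m) =
      if m = n then (topMoment (1 + α) A B n : ℂ) else 0 := by
  have hc : Continuous (conj : ℂ → ℂ) := Complex.continuous_conj
  have hcF := hF n
  have e : (fun ζ : ℂ => F n ζ * (A * conj ζ + B * ζ) ^ m) = fun ζ =>
      ∑ p ∈ Finset.HasAntidiagonal.antidiagonal m,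
        ((m.choose p.1 : ℂ) * A ^ p.1 * B ^ p.2) * (F n ζ * (ζ ^ p.2 * conj ζ ^ p.1)) := by
    funext ζ
    rw [(Commute.all _ _).add_pow', Finset.mul_sum]
    refine Finset.sum_congr rfl fun p _ => ?_
    rw [nsmul_eq_mul]
    ring
  rw [e, diskIntegral_sum hα _ (fun p _ => by fun_prop)]
  simp_rw [diskIntegral_const_mul, diskIntegral_mul_monomial hα hF h0 h1 h2]
  split_ifs with h
  · subst h
    rw [topMoment, homogSum, Finset.mul_sum, Complex.ofReal_sum]
    refine Finset.sum_congr rfl fun p hp => ?_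
    have hp' := Finset.HasAntidiagonal.mem_antidiagonal.1 hp
    rw [← hp', homogSum_diskCoeff_top, Nat.cast_add_choose, expCoeff]
    push_cast
    field_simp
    ring
  · refine Finset.sum_eq_zero fun p hp => ?_
    have hp' := Finset.HasAntidiagonal.mem_antidiagonal.1 hp
    rw [homogSum_diskCoeff_eq_zero (by omega)]
    simp

/-- The normalised area measure `dA_α` on the ellipse. -/
def gegenbauerMeasure (a b α : ℝ) : Measure ℂ :=
  weightedArea (ellipse a b) (gegenbauerWeight a b α)

theorem integral_gegenbauerMeasure {a b α : ℝ} (ha : 0 < a) (hb : 0 < b) (hα : -1 < α)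
    (F : ℂ → ℂ) :
    ∫ z, F z ∂gegenbauerMeasure a b α = diskIntegral α (fun ζ => F (diskToEllipse a b ζ)) := by
  rw [gegenbauerMeasure, integral_weightedArea (isOpen_ellipse a b).measurableSet
    (measurable_gegenbauerWeight a b α) (fun z hz => (gegenbauerWeight_pos ha hb hα hz).le),
    setIntegral_gegenbauerWeight ha hb, diskIntegral]

theorem integrable_gegenbauerMeasure {a b α : ℝ} (hb : 0 < b) (hab : b < a) (hα : -1 < α)
    {F : ℂ → ℂ} (hF : Continuous F) : Integrable F (gegenbauerMeasure a b α) := by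
  have ha := hb.trans hab
  rw [gegenbauerMeasure, integrable_weightedArea_iff (isOpen_ellipse a b).measurableSet
    (measurable_gegenbauerWeight a b α) (fun z hz => (gegenbauerWeight_pos ha hb hα hz).le)]
  exact integrableOn_mul_continuous (isCompact_closedBall 0 a) (ellipse_subset_closedBall hb hab)
    (isOpen_ellipse a b).measurableSet (integrableOn_gegenbauerWeight ha hb hα) hF

theorem integral_scaledGegenbauer_mul_conj {a b α s : ℝ} (hb : 0 < b) (hab : b < a) (hα : -1 < α)
    (hs : s ^ 2 * (a ^ 2 - b ^ 2) = 1) {n : ℕ} {g : ℂ[X]} (hg : g.natDegree ≤ n) :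
    ((1 / (2 * s) : ℝ) : ℂ) ^ n * ∫ z, (scaledGegenbauer (1 + α) s n).eval z * conj (g.eval z)
        ∂gegenbauerMeasure a b α =
      conj (g.coeff n) * (topMoment (1 + α) ((a + b) / 2) ((a - b) / 2) n : ℂ) := by
  have ha := hb.trans hab
  have hs0 : s ≠ 0 := by rintro rfl; simp at hs
  set A := (a + b) / 2 with hA
  set B := (a - b) / 2 with hB
  -- Thus `1 / (2s) = ± √(AB)`. Multiplying `C_n(s z)` by its `n`-th power clears the `s` from the
  -- recurrence and gives the form required of `F`.
  have hAB : (1 / (2 * s)) ^ 2 = A * B := by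
    rw [hA, hB]; field_simp; linarith
  have hz : ∀ ζ, diskToEllipse a b ζ = A * ζ + B * conj ζ := fun ζ => diskToEllipse_eq a b ζ
  have hzc : Continuous (diskToEllipse a b) := LinearMap.continuous_of_finiteDimensional _
  have hcz : ∀ ζ, conj (diskToEllipse a b ζ) = A * conj ζ + B * ζ := by
    intro ζ; rw [hz]; simp
  set r : ℝ := 1 / (2 * s) with hr
  have hrs : 2 * s * r = 1 := by rw [hr]; field_simp
  set F : ℕ → ℂ → ℂ := fun n ζ =>
    (r : ℂ) ^ n * (scaledGegenbauer (1 + α) s n).eval (diskToEllipse a b ζ) with hFdef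
  have hF : ∀ n, Continuous (F n) := fun n =>
    continuous_const.mul ((scaledGegenbauer (1 + α) s n).continuous.comp hzc)
  have hrs' : (2 : ℂ) * s * r = 1 := by exact_mod_cast hrs
  have h0 : ∀ ζ, F 0 ζ = 1 := fun ζ => by simp [hFdef, scaledGegenbauer_zero]
  have h1 : ∀ ζ, F 1 ζ = (1 + α : ℝ) * (A * ζ + B * conj ζ) := fun ζ => by
    simp only [hFdef, scaledGegenbauer_one, eval_mul, eval_C, eval_X]
    rw [← hz]
    push_cast
    linear_combination (1 + (α : ℂ)) * diskToEllipse a b ζ * hrs'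
  have h2 : ∀ (n : ℕ) ζ, (n + 2 : ℝ) * F (n + 2) ζ =
      (n + 1 + (1 + α) : ℝ) * ((A * ζ + B * conj ζ) * F (n + 1) ζ)
        - (n + 2 * (1 + α) : ℝ) * ((A * B : ℝ) * F n ζ) := fun n ζ => by
    have h := congrArg (eval (diskToEllipse a b ζ)) (scaledGegenbauer_recurrence (1 + α) s n)
    simp only [eval_sub, eval_mul, eval_C, eval_X] at h
    simp only [hFdef]
    rw [← hz, ← hAB]
    push_cast at h ⊢
    linear_combination (r : ℂ) ^ (n + 2) * h + (n + 1 + (1 + α) : ℂ) * r ^ (n + 1) *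
      diskToEllipse a b ζ * (scaledGegenbauer (1 + α) s (n + 1)).eval (diskToEllipse a b ζ) * hrs'
  rw [integral_gegenbauerMeasure ha hb hα, ← diskIntegral_const_mul]
  have e : (fun ζ : ℂ => (r : ℂ) ^ n * ((scaledGegenbauer (1 + α) s n).eval (diskToEllipse a b ζ) *
      conj (g.eval (diskToEllipse a b ζ)))) = fun ζ => ∑ m ∈ Finset.range (n + 1),
        conj (g.coeff m) * (F n ζ * (A * conj ζ + B * ζ) ^ m) := by
    funext ζ
    rw [eval_eq_sum_range' (Nat.lt_succ_of_le hg), map_sum, Finset.mul_sum, Finset.mul_sum]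
    refine Finset.sum_congr rfl fun m _ => ?_
    rw [map_mul, map_pow, hcz]
    ring
  have hc : Continuous (conj : ℂ → ℂ) := Complex.continuous_conj
  have hcF := hF n
  rw [e, diskIntegral_sum hα _ (fun m _ => by fun_prop), Finset.sum_range_succ,
    Finset.sum_eq_zero, zero_add, diskIntegral_const_mul,
    diskIntegral_mul_conj_pow hα hF h0 h1 h2 le_rfl, if_pos rfl]
  intro m hm
  have hm' := Finset.mem_range.1 hm
  rw [diskIntegral_const_mul, diskIntegral_mul_conj_pow hα hF h0 h1 h2 hm'.le, if_neg hm'.ne,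
    mul_zero]

theorem integral_scaledGegenbauer_sq {a b α s : ℝ} (hb : 0 < b) (hab : b < a) (hα : -1 < α)
    (hs : s ^ 2 * (a ^ 2 - b ^ 2) = 1) (n : ℕ) :
    ∫ z, (scaledGegenbauer (1 + α) s n).eval z * conj ((scaledGegenbauer (1 + α) s n).eval z)
        ∂gegenbauerMeasure a b α = (gegenbauerNorm a b α n : ℂ) := by
  have ha := hb.trans hab
  have hl : 0 < 1 + α := by linarith
  have hs0 : s ≠ 0 := by rintro rfl; simp at hs
  have hab2 : 0 < a ^ 2 - b ^ 2 := by nlinarith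
  obtain ⟨hdeg, hco⟩ := scaledGegenbauer_degree hl hs0 n
  have h := integral_scaledGegenbauer_mul_conj hb hab hα hs hdeg.le
  have hr : (((1 / (2 * s) : ℝ) : ℂ)) ^ n ≠ 0 :=
    pow_ne_zero _ (Complex.ofReal_ne_zero.2 (by positivity))
  have hX : 2 * ((a + b) / 2 * ((a - b) / 2)) * ((a ^ 2 + b ^ 2) / (a ^ 2 - b ^ 2)) =
      ((a + b) / 2) ^ 2 + ((a - b) / 2) ^ 2 := by
    field_simp; ring
  rw [← mul_right_inj' hr, h, hco, Complex.conj_ofReal, topMoment,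
    ← gegenbauer_eval_eq_homogSum hX, gegenbauerNorm, rising_succ,
    show (a + b) / 2 * ((a - b) / 2) = (1 / (2 * s)) * (1 / (2 * s)) by field_simp; linarith,
    mul_pow]
  norm_cast
  have := (rising_pos hl n).ne'
  have := Nat.factorial_ne_zero n
  have : 1 + α + n ≠ 0 := by positivity
  rw [div_pow, mul_pow, one_pow]
  field_simp
  push_cast
  rfl

theorem gegenbauerNorm_pos {a b α : ℝ} (hb : 0 < b) (hab : b < a) (hα : -1 < α) (n : ℕ) :
    0 < gegenbauerNorm a b α n := by
  have hl : 0 < 1 + α := by linarith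
  have hab2 : 0 < a ^ 2 - b ^ 2 := by nlinarith
  have hX : 2 * ((a + b) / 2 * ((a - b) / 2)) * ((a ^ 2 + b ^ 2) / (a ^ 2 - b ^ 2)) =
      ((a + b) / 2) ^ 2 + ((a - b) / 2) ^ 2 := by
    field_simp; ring
  have := gegenbauer_eval_pos hl (by linarith) (by linarith) hX n
  unfold gegenbauerNorm
  positivity

theorem gegenbauerON_eq (a b α : ℝ) (n : ℕ) :
    gegenbauerON a b α n = C (((1 / √(gegenbauerNorm a b α n) : ℝ) : ℂ)) *
      scaledGegenbauer (1 + α) (1 / √(a ^ 2 - b ^ 2)) n := rfl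

theorem inv_sqrt_sq_mul {x : ℝ} (hx : 0 < x) : (1 / √x) ^ 2 * x = 1 := by
  rw [div_pow, Real.sq_sqrt hx.le, one_pow]
  field_simp

/-- The leading coefficient of `p_n`. -/
def leadCoeffON (a b α : ℝ) (n : ℕ) : ℝ :=
  1 / √(gegenbauerNorm a b α n) *
    (2 ^ n * rising (1 + α) n / n.factorial * (1 / √(a ^ 2 - b ^ 2)) ^ n)

theorem leadCoeffON_pos {a b α : ℝ} (hb : 0 < b) (hab : b < a) (hα : -1 < α) (n : ℕ) :
    0 < leadCoeffON a b α n := by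
  have hab2 : 0 < a ^ 2 - b ^ 2 := by nlinarith
  have := gegenbauerNorm_pos hb hab hα n
  have := rising_pos (show 0 < 1 + α by linarith) n
  unfold leadCoeffON
  positivity

theorem gegenbauerON_natDegree {a b α : ℝ} (hb : 0 < b) (hab : b < a) (hα : -1 < α) (n : ℕ) :
    (gegenbauerON a b α n).natDegree = n ∧
      (gegenbauerON a b α n).coeff n = (leadCoeffON a b α n : ℂ) := by
  have hab2 : 0 < a ^ 2 - b ^ 2 := by nlinarith
  have hh := gegenbauerNorm_pos hb hab hα n
  obtain ⟨h1, h2⟩ := scaledGegenbauer_degree (show 0 < 1 + α by linarith)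
    (show 1 / √(a ^ 2 - b ^ 2) ≠ 0 by positivity) n
  have h3 : ((1 / √(gegenbauerNorm a b α n) : ℝ) : ℂ) ≠ 0 :=
    Complex.ofReal_ne_zero.2 (by positivity)
  constructor
  · rw [gegenbauerON_eq, natDegree_C_mul h3, h1]
  · rw [gegenbauerON_eq, coeff_C_mul, h2, leadCoeffON]
    norm_cast

theorem gegenbauerON_orthogonal {a b α : ℝ} (hb : 0 < b) (hab : b < a) (hα : -1 < α) {n : ℕ}
    {g : ℂ[X]} (hg : g.degree < n) :
    ∫ z, (gegenbauerON a b α n).eval z * conj (g.eval z) ∂gegenbauerMeasure a b α = 0 := by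
  have hab2 : 0 < a ^ 2 - b ^ 2 := by nlinarith
  have h := integral_scaledGegenbauer_mul_conj hb hab hα (inv_sqrt_sq_mul hab2)
    (natDegree_le_of_degree_le hg.le)
  rw [coeff_eq_zero_of_degree_lt hg, map_zero, zero_mul, mul_eq_zero, or_iff_right] at h
  · simp_rw [gegenbauerON_eq, eval_mul, eval_C, mul_assoc]
    rw [integral_const_mul, h, mul_zero]
  · exact pow_ne_zero _ (Complex.ofReal_ne_zero.2 (by positivity))

theorem gegenbauerON_norm {a b α : ℝ} (hb : 0 < b) (hab : b < a) (hα : -1 < α) (n : ℕ) :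
    ∫ z, (gegenbauerON a b α n).eval z * conj ((gegenbauerON a b α n).eval z)
      ∂gegenbauerMeasure a b α = 1 := by
  have hab2 : 0 < a ^ 2 - b ^ 2 := by nlinarith
  have h := integral_scaledGegenbauer_sq hb hab hα (inv_sqrt_sq_mul hab2) n
  simp_rw [gegenbauerON_eq, eval_mul, eval_C, map_mul, Complex.conj_ofReal, mul_mul_mul_comm]
  rw [integral_const_mul, h]
  norm_cast
  rw [← pow_two, inv_sqrt_sq_mul (gegenbauerNorm_pos hb hab hα n)]

/-! ### Orthonormal polynomials for a sesquilinear form -/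

/-- `p n` has degree `n` and the `p n` are orthonormal for the hermitian form `B`. -/
structure IsOrthonormalSystem (B : ℂ[X] →ₗ[ℂ] ℂ[X] →ₗ⋆[ℂ] ℂ) (p : ℕ → ℂ[X]) : Prop where
  conj_symm : ∀ f g, conj (B f g) = B g f
  natDegree_eq : ∀ n, (p n).natDegree = n
  orthonormal : ∀ n m, B (p n) (p m) = if n = m then 1 else 0

theorem form_C_mul_left (B : ℂ[X] →ₗ[ℂ] ℂ[X] →ₗ⋆[ℂ] ℂ) (c : ℂ) (f g : ℂ[X]) :
    B (C c * f) g = c * B f g := by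
  rw [← smul_eq_C_mul, map_smul, LinearMap.smul_apply, smul_eq_mul]

theorem form_C_mul_right (B : ℂ[X] →ₗ[ℂ] ℂ[X] →ₗ⋆[ℂ] ℂ) (c : ℂ) (f g : ℂ[X]) :
    B f (C c * g) = conj c * B f g := by
  rw [← smul_eq_C_mul, map_smulₛₗ, smul_eq_mul]

theorem form_sum_left (B : ℂ[X] →ₗ[ℂ] ℂ[X] →ₗ⋆[ℂ] ℂ) {ι : Type*} (s : Finset ι) (f : ι → ℂ[X])
    (g : ℂ[X]) : B (∑ i ∈ s, f i) g = ∑ i ∈ s, B (f i) g := by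
  rw [map_sum, LinearMap.sum_apply]

theorem form_sub_left (B : ℂ[X] →ₗ[ℂ] ℂ[X] →ₗ⋆[ℂ] ℂ) (f g h : ℂ[X]) :
    B (f - g) h = B f h - B g h := by
  rw [map_sub, LinearMap.sub_apply]

theorem form_add_left (B : ℂ[X] →ₗ[ℂ] ℂ[X] →ₗ⋆[ℂ] ℂ) (f g h : ℂ[X]) :
    B (f + g) h = B f h + B g h := by
  rw [map_add, LinearMap.add_apply]

namespace IsOrthonormalSystem

variable {B : ℂ[X] →ₗ[ℂ] ℂ[X] →ₗ⋆[ℂ] ℂ} {p : ℕ → ℂ[X]}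

theorem ne_zero (h : IsOrthonormalSystem B p) (n : ℕ) : p n ≠ 0 := by
  intro h0
  have := h.orthonormal n n
  simp [h0] at this

theorem degree_eq (h : IsOrthonormalSystem B p) (n : ℕ) : (p n).degree = n := by
  rw [degree_eq_natDegree (h.ne_zero n), h.natDegree_eq]

theorem exists_expansion (h : IsOrthonormalSystem B p) (N : ℕ) :
    ∀ f : ℂ[X], f.degree < N → ∃ c : ℕ → ℂ, f = ∑ i ∈ Finset.range N, C (c i) * p i := by
  induction N with
  | zero =>
    intro f hf
    have : f = 0 := by
      rw [← degree_eq_bot]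
      exact Nat.WithBot.lt_zero_iff.1 (by simpa using hf)
    exact ⟨0, by simp [this]⟩
  | succ N ih =>
    intro f hf
    have hlc : (p N).coeff N ≠ 0 := by
      have := leadingCoeff_ne_zero.2 (h.ne_zero N)
      rwa [leadingCoeff, h.natDegree_eq] at this
    set d := f.coeff N / (p N).coeff N
    have hd : (f - C d * p N).degree < N := by
      rw [degree_lt_iff_coeff_zero]
      intro m hm
      rcases hm.eq_or_lt with rfl | hm
      · rw [coeff_sub, coeff_C_mul, div_mul_cancel₀ _ hlc, sub_self]
      · rw [coeff_sub, coeff_C_mul,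
          coeff_eq_zero_of_natDegree_lt (p := p N) (by rwa [h.natDegree_eq]),
          coeff_eq_zero_of_degree_lt (hf.trans_le (by exact_mod_cast hm))]
        simp
    obtain ⟨c, hc⟩ := ih _ hd
    refine ⟨fun i => if i = N then d else c i, ?_⟩
    have hs : ∑ i ∈ Finset.range N, C (if i = N then d else c i) * p i =
        ∑ i ∈ Finset.range N, C (c i) * p i :=
      Finset.sum_congr rfl fun i hi => by rw [if_neg (Finset.mem_range.1 hi).ne]
    beta_reduce
    rw [Finset.sum_range_succ, if_pos rfl, hs, ← hc, sub_add_cancel]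

theorem form_sum (h : IsOrthonormalSystem B p) {N j : ℕ} (hj : j < N) (c : ℕ → ℂ) :
    B (∑ i ∈ Finset.range N, C (c i) * p i) (p j) = c j := by
  rw [form_sum_left, Finset.sum_eq_single j]
  · rw [form_C_mul_left, h.orthonormal, if_pos rfl, mul_one]
  · intro i _ hij
    rw [form_C_mul_left, h.orthonormal, if_neg hij, mul_zero]
  · intro hj'
    exact absurd (Finset.mem_range.2 hj) hj'

theorem expansion (h : IsOrthonormalSystem B p) {N : ℕ} {f : ℂ[X]} (hf : f.degree < N) :
    f = ∑ i ∈ Finset.range N, C (B f (p i)) * p i := by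
  obtain ⟨c, hc⟩ := h.exists_expansion N f hf
  conv_lhs => rw [hc]
  refine Finset.sum_congr rfl fun i hi => ?_
  rw [hc, h.form_sum (Finset.mem_range.1 hi)]

theorem form_eq_zero (h : IsOrthonormalSystem B p) {n : ℕ} {f : ℂ[X]} (hf : f.degree < n) :
    B f (p n) = 0 := by
  rw [h.expansion hf, form_sum_left]
  refine Finset.sum_eq_zero fun i hi => ?_
  rw [form_C_mul_left, h.orthonormal, if_neg (Finset.mem_range.1 hi).ne, mul_zero]

theorem form_eq_zero' (h : IsOrthonormalSystem B p) {n : ℕ} {f : ℂ[X]} (hf : f.degree < n) :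
    B (p n) f = 0 := by
  rw [← h.conj_symm, h.form_eq_zero hf, map_zero]

/-- The orthonormal polynomials with positive leading coefficients are unique. -/
theorem unique {q : ℕ → ℂ[X]} (h : IsOrthonormalSystem B p) (h' : IsOrthonormalSystem B q)
    (hp : ∀ n, 0 < (p n).leadingCoeff.re ∧ (p n).leadingCoeff.im = 0)
    (hq : ∀ n, 0 < (q n).leadingCoeff.re ∧ (q n).leadingCoeff.im = 0) : p = q := by
  funext n
  have hlt : ∀ {i}, i < n → ((q i).degree : WithBot ℕ) < n := fun hi => by
    rw [h'.degree_eq]; exact_mod_cast hi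
  have h1 := h'.expansion (f := p n) (N := n + 1)
    (by rw [h.degree_eq]; exact_mod_cast Nat.lt_succ_self n)
  rw [Finset.sum_range_succ, Finset.sum_eq_zero, zero_add] at h1
  · set c := B (p n) (q n)
    -- Only the top term of the expansion survives, so `p_n = c q_n`; equal norms give `|c| = 1`,
    -- and the positive leading coefficients give `c > 0`.
    have h2 : c * conj c = 1 := by
      have := h.orthonormal n n
      rwa [if_pos rfl, h1, form_C_mul_left, form_C_mul_right, h'.orthonormal, if_pos rfl,
        mul_one] at this
    have h3 : (p n).leadingCoeff = c * (q n).leadingCoeff := by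
      rw [h1, leadingCoeff_mul, leadingCoeff_C]
    obtain ⟨hp1, hp2⟩ := hp n
    obtain ⟨hq1, hq2⟩ := hq n
    rw [h3, Complex.mul_re, hq2] at hp1
    rw [h3, Complex.mul_im, hq2] at hp2
    have hre : 0 < c.re := pos_of_mul_pos_left (by linarith) hq1.le
    have him : c.im = 0 := by
      rcases mul_eq_zero.1 (show c.im * (q n).leadingCoeff.re = 0 by linarith) with h | h
      · exact h
      · linarith
    rw [Complex.mul_conj, Complex.normSq_apply, him] at h2
    have h4 : c.re * c.re + 0 * 0 = 1 := by exact_mod_cast h2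
    have hc1 : c = 1 := by
      apply Complex.ext
      · rw [Complex.one_re]; nlinarith
      · exact him
    rw [h1, hc1, C_1, one_mul]
  · intro i hi
    rw [h.form_eq_zero' (hlt (Finset.mem_range.1 hi)), C_0, zero_mul]

end IsOrthonormalSystem

/-! ### The form of a measure -/

/-- The hermitian form `(f, g) ↦ ∫ f conj(g) dν`. -/
def measureForm (ν : Measure ℂ)
    (hν : ∀ f g : ℂ[X], Integrable (fun z => f.eval z * conj (g.eval z)) ν) :
    ℂ[X] →ₗ[ℂ] ℂ[X] →ₗ⋆[ℂ] ℂ :=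
  LinearMap.mk₂'ₛₗ (RingHom.id ℂ) (starRingEnd ℂ)
    (fun f g => ∫ z, f.eval z * conj (g.eval z) ∂ν)
    (fun f₁ f₂ g => by
      rw [← integral_add (hν f₁ g) (hν f₂ g)]
      simp only [eval_add, add_mul])
    (fun c f g => by
      rw [RingHom.id_apply, smul_eq_mul, ← integral_const_mul]
      simp only [eval_smul, smul_eq_mul, mul_assoc])
    (fun f g₁ g₂ => by
      rw [← integral_add (hν f g₁) (hν f g₂)]
      simp only [eval_add, map_add, mul_add])
    (fun c f g => by
      rw [smul_eq_mul, ← integral_const_mul]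
      simp only [eval_smul, smul_eq_mul, map_mul, mul_left_comm])

theorem measureForm_apply {ν : Measure ℂ}
    (hν : ∀ f g : ℂ[X], Integrable (fun z => f.eval z * conj (g.eval z)) ν) (f g : ℂ[X]) :
    measureForm ν hν f g = ∫ z, f.eval z * conj (g.eval z) ∂ν := rfl

theorem measureForm_conj {ν : Measure ℂ}
    (hν : ∀ f g : ℂ[X], Integrable (fun z => f.eval z * conj (g.eval z)) ν) (f g : ℂ[X]) :
    conj (measureForm ν hν f g) = measureForm ν hν g f := by
  rw [measureForm_apply, measureForm_apply, ← integral_conj]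
  simp only [map_mul, Complex.conj_conj, mul_comm]

theorem IsBergmanSystem.isOrthonormalSystem {ν : Measure ℂ} {P : ℕ → ℂ[X]}
    (hν : ∀ f g : ℂ[X], Integrable (fun z => f.eval z * conj (g.eval z)) ν)
    (h : IsBergmanSystem ν P) : IsOrthonormalSystem (measureForm ν hν) P :=
  ⟨measureForm_conj hν, h.natDegree_eq, h.orthonormal⟩

theorem fourierCoeff_eq {ν : Measure ℂ}
    (hν : ∀ f g : ℂ[X], Integrable (fun z => f.eval z * conj (g.eval z)) ν) (P : ℕ → ℂ[X])
    (l n : ℕ) : fourierCoeff ν P l n = measureForm ν hν (X * P n) (P l) := by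
  rw [measureForm_apply, fourierCoeff]
  simp only [eval_mul, eval_X]

/-- Multiplication by `z` in terms of the Fourier coefficients. -/
theorem IsBergmanSystem.X_mul {ν : Measure ℂ} {P : ℕ → ℂ[X]}
    (hν : ∀ f g : ℂ[X], Integrable (fun z => f.eval z * conj (g.eval z)) ν)
    (h : IsBergmanSystem ν P) (n : ℕ) :
    X * P n = ∑ l ∈ Finset.range (n + 2), C (fourierCoeff ν P l n) * P l := by
  have h' := h.isOrthonormalSystem hν
  simp_rw [fourierCoeff_eq hν]
  refine h'.expansion ?_
  rw [degree_mul, degree_X, h'.degree_eq]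
  exact_mod_cast (by omega : 1 + n < n + 2)

/-! ### The three-term relation -/

/-- The coefficient of `p_{n+1}` in `z p_n`. -/
def recUp (a b α : ℝ) (n : ℕ) : ℝ :=
  (n + 1) * √(a ^ 2 - b ^ 2) / (2 * (n + (1 + α))) *
    (√(gegenbauerNorm a b α (n + 1)) / √(gegenbauerNorm a b α n))

/-- The coefficient of `p_n` in `z p_{n+1}`. -/
def recDown (a b α : ℝ) (n : ℕ) : ℝ :=
  (n + 2 * (1 + α)) * √(a ^ 2 - b ^ 2) / (2 * (n + 1 + (1 + α))) *
    (√(gegenbauerNorm a b α n) / √(gegenbauerNorm a b α (n + 1)))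

theorem X_mul_gegenbauerON_zero {a b α : ℝ} (hb : 0 < b) (hab : b < a) (hα : -1 < α) :
    X * gegenbauerON a b α 0 = C (recUp a b α 0 : ℂ) * gegenbauerON a b α 1 := by
  have hab2 : 0 < a ^ 2 - b ^ 2 := by nlinarith
  have h0 := gegenbauerNorm_pos hb hab hα 0
  have h1 := gegenbauerNorm_pos hb hab hα 1
  have hl : 0 < 1 + α := by linarith
  have e : recUp a b α 0 * (1 / √(gegenbauerNorm a b α 1) *
      (2 * (1 + α) * (1 / √(a ^ 2 - b ^ 2)))) = 1 / √(gegenbauerNorm a b α 0) := by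
    simp only [recUp, Nat.cast_zero, zero_add]
    field_simp
  rw [gegenbauerON_eq, gegenbauerON_eq, scaledGegenbauer_zero, scaledGegenbauer_one, ← e]
  simp only [Complex.ofReal_mul, C_mul]
  ring

theorem X_mul_gegenbauerON_succ {a b α : ℝ} (hb : 0 < b) (hab : b < a) (hα : -1 < α) (n : ℕ) :
    X * gegenbauerON a b α (n + 1) = C (recUp a b α (n + 1) : ℂ) * gegenbauerON a b α (n + 2) +
      C (recDown a b α n : ℂ) * gegenbauerON a b α n := by
  have hab2 : 0 < a ^ 2 - b ^ 2 := by nlinarith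
  have h0 := gegenbauerNorm_pos hb hab hα n
  have h1 := gegenbauerNorm_pos hb hab hα (n + 1)
  have h2 := gegenbauerNorm_pos hb hab hα (n + 2)
  have hl : 0 < 1 + α := by linarith
  have hn : 0 < (n : ℝ) + 1 + (1 + α) := by positivity
  set r : ℝ := √(a ^ 2 - b ^ 2) / (2 * (n + 1 + (1 + α))) / √(gegenbauerNorm a b α (n + 1))
    with hr
  have e1 : recUp a b α (n + 1) * (1 / √(gegenbauerNorm a b α (n + 2))) = r * (n + 2) := by
    rw [recUp, hr]
    push_cast
    rw [show n + 1 + 1 = n + 2 by ring]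
    field_simp
    ring
  have e2 : recDown a b α n * (1 / √(gegenbauerNorm a b α n)) = r * (n + 2 * (1 + α)) := by
    rw [recDown, hr]
    field_simp
  have e3 : 1 / √(gegenbauerNorm a b α (n + 1)) =
      r * (2 * (n + 1 + (1 + α)) * (1 / √(a ^ 2 - b ^ 2))) := by
    rw [hr]
    field_simp
  have h := scaledGegenbauer_recurrence (1 + α) (1 / √(a ^ 2 - b ^ 2)) n
  rw [gegenbauerON_eq, gegenbauerON_eq, gegenbauerON_eq, ← mul_assoc (C _) (C _), ← C_mul,
    ← Complex.ofReal_mul, e1, ← mul_assoc (C _) (C _), ← C_mul, ← Complex.ofReal_mul, e2, e3,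
    Complex.ofReal_mul r, Complex.ofReal_mul r, Complex.ofReal_mul r, C_mul, C_mul, C_mul]
  linear_combination -C (r : ℂ) * h

theorem conj_gegenbauerON_eval (a b α : ℝ) (n : ℕ) (z : ℂ) :
    conj ((gegenbauerON a b α n).eval z) = (gegenbauerON a b α n).eval (conj z) := by
  rw [gegenbauerON_eq, eval_mul, eval_mul, map_mul, conj_scaledGegenbauer_eval, eval_C, eval_C,
    Complex.conj_ofReal]

theorem gegenbauerON_zero {a b α : ℝ} (hα : -1 < α) : gegenbauerON a b α 0 = 1 := by
  have : 1 + α ≠ 0 := by linarith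
  rw [gegenbauerON_eq, scaledGegenbauer_zero]
  simp [gegenbauerNorm, gegenbauer, this]

theorem kernelDiag_pos {a b α : ℝ} (hα : -1 < α) (N : ℕ) (v : ℂ) :
    0 < kernelDiag a b α (N + 1) v := by
  refine Finset.sum_pos' (fun i _ => by positivity) ⟨0, by simp, ?_⟩
  simp [gegenbauerON_zero hα]

theorem kernelDiag_eq_sum (a b α : ℝ) (N : ℕ) (v : ℂ) :
    (kernelDiag a b α N v : ℂ) = ∑ i ∈ Finset.range N,
      (gegenbauerON a b α i).eval v * (gegenbauerON a b α i).eval (conj v) := by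
  rw [kernelDiag, Complex.ofReal_sum]
  refine Finset.sum_congr rfl fun i _ => ?_
  rw [← conj_gegenbauerON_eval, Complex.mul_conj, Complex.normSq_eq_norm_sq]

/-! ### The Christoffel transform -/

theorem degree_C_mul_le_degree (c : ℂ) (f : ℂ[X]) : (C c * f).degree ≤ f.degree := by
  rw [← smul_eq_C_mul]
  exact degree_smul_le c f

section Christoffel

variable {a b α : ℝ} {B : ℂ[X] →ₗ[ℂ] ℂ[X] →ₗ⋆[ℂ] ℂ}

theorem kernelPoly_reproducing (h : IsOrthonormalSystem B (gegenbauerON a b α)) {N : ℕ} {v : ℂ}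
    {f : ℂ[X]} (hf : f.degree < N) : B (kernelPoly a b α N v) f = conj (f.eval v) := by
  conv_rhs => rw [h.expansion hf]
  rw [kernelPoly, form_sum_left, eval_finsetSum, map_sum]
  refine Finset.sum_congr rfl fun i _ => ?_
  rw [form_C_mul_left, eval_mul, eval_C, map_mul, h.conj_symm, mul_comm]

theorem kernelPoly_degree_lt (h : IsOrthonormalSystem B (gegenbauerON a b α)) (N : ℕ) (v : ℂ) :
    (kernelPoly a b α N v).degree < N := by
  rw [kernelPoly]
  refine (degree_sum_le _ _).trans_lt ((Finset.sup_lt_iff (WithBot.bot_lt_coe N)).2 fun i hi => ?_)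
  refine (degree_C_mul_le_degree _ _).trans_lt ?_
  rw [h.degree_eq]
  exact WithBot.coe_lt_coe.2 (Finset.mem_range.1 hi)

theorem kernelPoly_eval_self (a b α : ℝ) (N : ℕ) (v : ℂ) :
    (kernelPoly a b α N v).eval v = (kernelDiag a b α N v : ℂ) := by
  rw [kernelDiag_eq_sum, kernelPoly, eval_finsetSum]
  refine Finset.sum_congr rfl fun i _ => ?_
  rw [eval_mul, eval_C, conj_gegenbauerON_eval, mul_comm]

theorem christoffelNumerator_degree_lt (h : IsOrthonormalSystem B (gegenbauerON a b α)) (N : ℕ)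
    (v : ℂ) : (christoffelNumerator a b α v N).degree < (N + 2 : ℕ) := by
  rw [christoffelNumerator]
  refine (degree_sub_le _ _).trans_lt (max_lt ?_ ?_)
  · refine (degree_C_mul_le_degree _ _).trans_lt ((kernelPoly_degree_lt h _ _).trans ?_)
    exact_mod_cast Nat.lt_succ_self _
  · refine (degree_C_mul_le_degree _ _).trans_lt ?_
    rw [h.degree_eq]
    exact_mod_cast Nat.lt_succ_self _

/-- The kernel pairs with `f` to `conj (f(v)) = 0`, and `p_{N+1}` is orthogonal to lower degrees.
For a numerator of smaller index in the role of `f`, this is the orthogonality of the `P_N`. -/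
theorem form_christoffelNumerator_eq_zero (h : IsOrthonormalSystem B (gegenbauerON a b α)) {N : ℕ}
    {v : ℂ} {f : ℂ[X]} (hf : f.degree < (N + 1 : ℕ)) (hv : f.eval v = 0) :
    B (christoffelNumerator a b α v N) f = 0 := by
  rw [christoffelNumerator, form_sub_left, form_C_mul_left, form_C_mul_left,
    kernelPoly_reproducing h hf, h.form_eq_zero' hf, hv]
  simp

/-- The kernel and `p_{N+1}` are orthogonal, so the squared norm is `|p_{N+1}(v)|² κ + κ²` with `κ =
κ_{N+1}(v, conj v)`, and `κ + |p_{N+1}(v)|²` is the next diagonal value. -/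
theorem form_christoffelNumerator_self (h : IsOrthonormalSystem B (gegenbauerON a b α)) (N : ℕ)
    (v : ℂ) : B (christoffelNumerator a b α v N) (christoffelNumerator a b α v N) =
      ((kernelDiag a b α (N + 1) v * kernelDiag a b α (N + 2) v : ℝ) : ℂ) := by
  have hK := kernelPoly_degree_lt h (N + 1) v
  have h2 : (kernelDiag a b α (N + 2) v : ℂ) = kernelDiag a b α (N + 1) v +
      (gegenbauerON a b α (N + 1)).eval v * conj ((gegenbauerON a b α (N + 1)).eval v) := by
    rw [kernelDiag_eq_sum, kernelDiag_eq_sum, conj_gegenbauerON_eval, Finset.sum_range_succ]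
  have h3 : B (kernelPoly a b α (N + 1) v) (kernelPoly a b α (N + 1) v) =
      kernelDiag a b α (N + 1) v := by
    rw [kernelPoly_reproducing h hK, kernelPoly_eval_self, Complex.conj_ofReal]
  have h4 := h.orthonormal (N + 1) (N + 1)
  rw [if_pos rfl] at h4
  rw [christoffelNumerator, map_sub, form_sub_left, form_sub_left]
  simp only [form_C_mul_left, form_C_mul_right, h3, h4, h.form_eq_zero hK, h.form_eq_zero' hK,
    Complex.conj_ofReal]
  rw [Complex.ofReal_mul, h2]
  ring

theorem form_christoffelNumerator (h : IsOrthonormalSystem B (gegenbauerON a b α)) (N M : ℕ)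
    (v : ℂ) : B (christoffelNumerator a b α v N) (christoffelNumerator a b α v M) =
      if N = M then ((kernelDiag a b α (N + 1) v * kernelDiag a b α (N + 2) v : ℝ) : ℂ) else 0 := by
  rcases lt_trichotomy N M with hlt | rfl | hlt
  · rw [if_neg hlt.ne, ← h.conj_symm, form_christoffelNumerator_eq_zero h
      ((christoffelNumerator_degree_lt h N v).trans_le (by exact_mod_cast (by omega)))
      (christoffelNumerator_eval a b α v N), map_zero]
  · rw [if_pos rfl, form_christoffelNumerator_self h]
  · rw [if_neg hlt.ne', form_christoffelNumerator_eq_zero h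
      ((christoffelNumerator_degree_lt h M v).trans_le (by exact_mod_cast (by omega)))
      (christoffelNumerator_eval a b α v M)]

/-- The coefficients of the kernel of `z f(z)` at `w = conj v` in the basis `p_j`. -/
def transferCoeff (a b α : ℝ) (w : ℂ) : ℕ → ℂ
  | 0 => recDown a b α 0 * (gegenbauerON a b α 1).eval w
  | j + 1 => recUp a b α j * (gegenbauerON a b α j).eval w +
      recDown a b α (j + 1) * (gegenbauerON a b α (j + 2)).eval w

/-- The factor of the Fourier coefficient `c_{l,n}(v)` that is independent of `n`, at `z = v` and
`w = conj v`. -/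
def recurrenceDefect (a b α : ℝ) (l : ℕ) (z w : ℂ) : ℂ :=
  (gegenbauerON a b α (l + 1)).eval w *
      ∑ j ∈ Finset.range (l + 1), (gegenbauerON a b α j).eval z * transferCoeff a b α w j
    - (∑ j ∈ Finset.range (l + 1), (gegenbauerON a b α j).eval z * (gegenbauerON a b α j).eval w) *
        transferCoeff a b α w (l + 1)

/-- The coefficient of `p_j` in `z κ_{n+1}` comes from the kernel terms `p_{j-1}` and `p_{j+1}`
only. Both are present when `j < n`, so the truncation of the kernel is invisible and the result
does not depend on `n`. -/
theorem form_X_mul_kernelPoly (hb : 0 < b) (hab : b < a) (hα : -1 < α)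
    (h : IsOrthonormalSystem B (gegenbauerON a b α)) {n j : ℕ} (hj : j < n) (v : ℂ) :
    B (X * kernelPoly a b α (n + 1) v) (gegenbauerON a b α j) =
      transferCoeff a b α (conj v) j := by
  have e : X * kernelPoly a b α (n + 1) v =
      ∑ i ∈ Finset.range (n + 1), C ((gegenbauerON a b α i).eval (conj v) * recUp a b α i) *
          gegenbauerON a b α (i + 1) +
        ∑ i ∈ Finset.range n, C ((gegenbauerON a b α (i + 1)).eval (conj v) * recDown a b α i) *
          gegenbauerON a b α i := by
    rw [kernelPoly, Finset.mul_sum, Finset.sum_range_succ', Finset.sum_range_succ' _ n,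
      add_right_comm, ← Finset.sum_add_distrib]
    simp only [conj_gegenbauerON_eval, C_mul]
    congr 1
    · refine Finset.sum_congr rfl fun i _ => ?_
      linear_combination C ((gegenbauerON a b α (i + 1)).eval (conj v)) *
        X_mul_gegenbauerON_succ hb hab hα i
    · linear_combination C ((gegenbauerON a b α 0).eval (conj v)) *
        X_mul_gegenbauerON_zero hb hab hα
  rw [e, form_add_left, h.form_sum hj, form_sum_left]
  simp only [form_C_mul_left, h.orthonormal]
  cases j with
  | zero => simp [transferCoeff, mul_comm]
  | succ j =>
    simp only [transferCoeff, Nat.add_right_cancel_iff, mul_ite, mul_one, mul_zero]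
    rw [Finset.sum_ite_eq' (Finset.range (n + 1)) j, if_pos (Finset.mem_range.2 (by omega))]
    ring

/-- The numerator of `P_l` involves only `p_j` with `j ≤ l + 1 < n`, whereas `z p_{n+1}` is a
combination of `p_n` and `p_{n+2}`. Only `p_{n+1}(v) z κ_{n+1}` contributes, so `n` enters through
`p_{n+1}(v)` alone. -/
theorem form_X_mul_christoffelNumerator (hb : 0 < b) (hab : b < a) (hα : -1 < α)
    (h : IsOrthonormalSystem B (gegenbauerON a b α)) {l n : ℕ} (hln : l + 2 ≤ n) (v : ℂ) :
    B (X * christoffelNumerator a b α v n) (christoffelNumerator a b α v l) =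
      (gegenbauerON a b α (n + 1)).eval v * recurrenceDefect a b α l v (conj v) := by
  have key : ∀ j, j < n → B (X * christoffelNumerator a b α v n) (gegenbauerON a b α j) =
      (gegenbauerON a b α (n + 1)).eval v * transferCoeff a b α (conj v) j := by
    intro j hj
    rw [christoffelNumerator, mul_sub, mul_left_comm, mul_left_comm X, form_sub_left,
      form_C_mul_left, form_C_mul_left, form_X_mul_kernelPoly hb hab hα h hj,
      X_mul_gegenbauerON_succ hb hab hα n, form_add_left, form_C_mul_left, form_C_mul_left,
      h.orthonormal, h.orthonormal, if_neg (by omega), if_neg (by omega)]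
    ring
  conv_lhs => rw [christoffelNumerator.eq_def a b α v l]
  rw [map_sub, form_C_mul_right, form_C_mul_right, Complex.conj_ofReal, key (l + 1) (by omega),
    kernelPoly, map_sum, kernelDiag_eq_sum, recurrenceDefect, conj_gegenbauerON_eval, mul_sub,
    Finset.mul_sum, Finset.mul_sum, Finset.mul_sum]
  congr 1
  · refine Finset.sum_congr rfl fun j hj => ?_
    rw [form_C_mul_right, key j (by have := Finset.mem_range.1 hj; omega), Complex.conj_conj]
    ring
  · ring

end Christoffel

/-! ### Orthonormal polynomials of the Christoffel measure -/

theorem integrable_gegenbauerMeasure_form {a b α : ℝ} (hb : 0 < b) (hab : b < a) (hα : -1 < α)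
    (f g : ℂ[X]) :
    Integrable (fun z => f.eval z * conj (g.eval z)) (gegenbauerMeasure a b α) :=
  integrable_gegenbauerMeasure hb hab hα
    (f.continuous.mul (Complex.continuous_conj.comp g.continuous))

theorem gegenbauerON_isOrthonormalSystem {a b α : ℝ} (hb : 0 < b) (hab : b < a) (hα : -1 < α) :
    IsOrthonormalSystem (measureForm (gegenbauerMeasure a b α)
      (integrable_gegenbauerMeasure_form hb hab hα)) (gegenbauerON a b α) := by
  have hdeg := fun n => (gegenbauerON_natDegree hb hab hα n).1
  have hlt : ∀ {n m}, m < n → (gegenbauerON a b α m).degree < n := fun {n m} hm =>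
    degree_le_natDegree.trans_lt (by rw [hdeg]; exact_mod_cast hm)
  refine ⟨measureForm_conj _, hdeg, fun n m => ?_⟩
  rcases lt_trichotomy n m with h | rfl | h
  · rw [if_neg h.ne, ← measureForm_conj, measureForm_apply,
      gegenbauerON_orthogonal hb hab hα (hlt h), map_zero]
  · rw [if_pos rfl, measureForm_apply, gegenbauerON_norm hb hab hα]
  · rw [if_neg h.ne', measureForm_apply, gegenbauerON_orthogonal hb hab hα (hlt h)]

theorem measurable_christoffelWeight (a b α : ℝ) (v : ℂ) :
    Measurable (fun z => ‖v - z‖ ^ 2 * gegenbauerWeight a b α z) := by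
  have := measurable_gegenbauerWeight a b α
  fun_prop

theorem christoffelWeight_nonneg {a b α : ℝ} (ha : 0 < a) (hb : 0 < b) (hα : -1 < α) (v : ℂ) {z : ℂ}
    (hz : z ∈ ellipse a b) : 0 ≤ ‖v - z‖ ^ 2 * gegenbauerWeight a b α z := by
  have := gegenbauerWeight_pos ha hb hα hz
  positivity

theorem christoffelWeight_smul (a b α : ℝ) (v z w : ℂ) :
    (‖v - z‖ ^ 2 * gegenbauerWeight a b α z) • w =
      gegenbauerWeight a b α z • ((v - z) * conj (v - z) * w) := by
  rw [Complex.mul_conj, Complex.normSq_eq_norm_sq]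
  simp only [Complex.real_smul]
  push_cast
  ring

theorem integral_christoffelMeasure {a b α : ℝ} (ha : 0 < a) (hb : 0 < b) (hα : -1 < α) (v : ℂ)
    (F : ℂ → ℂ) : ∫ z, F z ∂christoffelMeasure a b α v =
      ∫ z, (v - z) * conj (v - z) * F z ∂gegenbauerMeasure a b α := by
  rw [christoffelMeasure, integral_weightedArea (isOpen_ellipse a b).measurableSet
    (measurable_christoffelWeight a b α v) (fun z hz => christoffelWeight_nonneg ha hb hα v hz),
    gegenbauerMeasure, integral_weightedArea (isOpen_ellipse a b).measurableSet
    (measurable_gegenbauerWeight a b α) (fun z hz => (gegenbauerWeight_pos ha hb hα hz).le)]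
  simp_rw [christoffelWeight_smul]

theorem integrableOn_christoffelWeight_smul {a b α : ℝ} (hb : 0 < b) (hab : b < a) (hα : -1 < α)
    (v : ℂ) {F : ℂ → ℂ} (hF : Continuous F) :
    IntegrableOn (fun z => (‖v - z‖ ^ 2 * gegenbauerWeight a b α z) • F z) (ellipse a b) := by
  have ha := hb.trans hab
  simp_rw [christoffelWeight_smul]
  have hc : Continuous (conj : ℂ → ℂ) := Complex.continuous_conj
  exact integrableOn_mul_continuous (isCompact_closedBall 0 a) (ellipse_subset_closedBall hb hab)
    (isOpen_ellipse a b).measurableSet (integrableOn_gegenbauerWeight ha hb hα) (by fun_prop)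

theorem integrable_christoffelMeasure_form {a b α : ℝ} (hb : 0 < b) (hab : b < a) (hα : -1 < α)
    (v : ℂ) (f g : ℂ[X]) :
    Integrable (fun z => f.eval z * conj (g.eval z)) (christoffelMeasure a b α v) := by
  have ha := hb.trans hab
  rw [christoffelMeasure, integrable_weightedArea_iff (isOpen_ellipse a b).measurableSet
    (measurable_christoffelWeight a b α v) (fun z hz => christoffelWeight_nonneg ha hb hα v hz)]
  exact integrableOn_christoffelWeight_smul hb hab hα v
    (f.continuous.mul (Complex.continuous_conj.comp g.continuous))

/-- Splitting `|v - z|²` as `(v - z) conj(v - z)` moves the weight into the arguments, which reduces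
the new measure to computations with the `p_n`. -/
theorem measureForm_christoffelMeasure {a b α : ℝ} (hb : 0 < b) (hab : b < a) (hα : -1 < α) (v : ℂ)
    (f g : ℂ[X]) :
    measureForm (christoffelMeasure a b α v) (integrable_christoffelMeasure_form hb hab hα v) f g =
      measureForm (gegenbauerMeasure a b α) (integrable_gegenbauerMeasure_form hb hab hα)
        ((C v - X) * f) ((C v - X) * g) := by
  rw [measureForm_apply, measureForm_apply, integral_christoffelMeasure (hb.trans hab) hb hα]
  simp only [eval_mul, eval_sub, eval_C, eval_X, map_mul]
  refine integral_congr_ae (Filter.Eventually.of_forall fun z => ?_)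
  beta_reduce
  ring

/-- The normalising factor of `christoffelPoly`. -/
def christoffelScale (a b α : ℝ) (v : ℂ) (N : ℕ) : ℝ :=
  1 / √(kernelDiag a b α (N + 1) v * kernelDiag a b α (N + 2) v)

theorem christoffelScale_pos {a b α : ℝ} (hα : -1 < α) (v : ℂ) (N : ℕ) :
    0 < christoffelScale a b α v N := by
  have := kernelDiag_pos (a := a) (b := b) hα N v
  have := kernelDiag_pos (a := a) (b := b) hα (N + 1) v
  unfold christoffelScale
  positivity

theorem christoffelNumerator_coeff {a b α : ℝ} (hb : 0 < b) (hab : b < a) (hα : -1 < α) (v : ℂ)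
    (N : ℕ) : (christoffelNumerator a b α v N).coeff (N + 1) =
      ((-(kernelDiag a b α (N + 1) v * leadCoeffON a b α (N + 1)) : ℝ) : ℂ) := by
  rw [christoffelNumerator, coeff_sub, coeff_C_mul, coeff_C_mul,
    coeff_eq_zero_of_degree_lt (kernelPoly_degree_lt
      (gegenbauerON_isOrthonormalSystem hb hab hα) (N + 1) v),
    (gegenbauerON_natDegree hb hab hα _).2]
  push_cast
  ring

theorem christoffelPoly_degree {a b α : ℝ} (hb : 0 < b) (hab : b < a) (hα : -1 < α) (v : ℂ)
    (N : ℕ) : (christoffelPoly a b α v N).natDegree = N ∧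
      (christoffelPoly a b α v N).leadingCoeff =
        ((christoffelScale a b α v N * (kernelDiag a b α (N + 1) v * leadCoeffON a b α (N + 1)) : ℝ)
          : ℂ) := by
  have hk := kernelDiag_pos (a := a) (b := b) hα N v
  have hs := christoffelScale_pos (a := a) (b := b) hα v N
  have hl := leadCoeffON_pos hb hab hα (N + 1)
  have hs' : (christoffelScale a b α v N : ℂ) ≠ 0 := Complex.ofReal_ne_zero.2 hs.ne'
  have hco := christoffelNumerator_coeff hb hab hα v N
  have hne : (christoffelNumerator a b α v N).coeff (N + 1) ≠ 0 := by
    rw [hco]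
    exact Complex.ofReal_ne_zero.2 (by nlinarith [mul_pos hk hl])
  have hdeg : (christoffelNumerator a b α v N).natDegree = N + 1 := by
    refine natDegree_eq_of_le_of_coeff_ne_zero (Nat.lt_succ_iff.1 ?_) hne
    refine (natDegree_lt_iff_degree_lt ?_).2 (christoffelNumerator_degree_lt
      (gegenbauerON_isOrthonormalSystem hb hab hα) N v)
    intro h0
    rw [h0] at hne
    simp at hne
  have h := sub_mul_christoffelPoly a b α v N
  have h' : (X - C v) * christoffelPoly a b α v N =
      C (-(christoffelScale a b α v N : ℂ)) * christoffelNumerator a b α v N := by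
    rw [C_neg, christoffelScale]
    linear_combination -h
  have hs'' : -(christoffelScale a b α v N : ℂ) ≠ 0 := neg_ne_zero.2 hs'
  have hd := congrArg natDegree h'
  rw [natDegree_C_mul hs'', hdeg, (monic_X_sub_C v).natDegree_mul', natDegree_X_sub_C] at hd
  · refine ⟨by omega, ?_⟩
    have hl := congrArg leadingCoeff h'
    rw [leadingCoeff_mul, leadingCoeff_X_sub_C, one_mul, leadingCoeff_mul, leadingCoeff_C,
      leadingCoeff, leadingCoeff, hdeg, hco] at hl
    rw [leadingCoeff, hl]
    push_cast
    ring
  · intro h0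
    rw [h0, mul_zero] at h'
    rcases mul_eq_zero.1 h'.symm with h1 | h1
    · exact hs'' (C_eq_zero.1 h1)
    · rw [h1] at hne
      simp at hne

theorem christoffelPoly_isBergmanSystem {a b α : ℝ} (hb : 0 < b) (hab : b < a) (hα : -1 < α)
    (v : ℂ) : IsBergmanSystem (christoffelMeasure a b α v) (christoffelPoly a b α v) := by
  refine ⟨fun n => (christoffelPoly_degree hb hab hα v n).1, fun n => ?_,
    fun n m => integrable_christoffelMeasure_form hb hab hα v _ _, fun n m => ?_⟩
  · rw [(christoffelPoly_degree hb hab hα v n).2]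
    have h1 := kernelDiag_pos (a := a) (b := b) hα n v
    have h2 := christoffelScale_pos (a := a) (b := b) hα v n
    have h3 := leadCoeffON_pos hb hab hα (n + 1)
    exact ⟨by rw [Complex.ofReal_re]; positivity, Complex.ofReal_im _⟩
  · rw [← measureForm_apply (integrable_christoffelMeasure_form hb hab hα v),
      measureForm_christoffelMeasure hb hab hα, sub_mul_christoffelPoly, sub_mul_christoffelPoly,
      form_C_mul_left, form_C_mul_right,
      form_christoffelNumerator (gegenbauerON_isOrthonormalSystem hb hab hα)]
    split_ifs with h
    · subst h
      have h1 := kernelDiag_pos (a := a) (b := b) hα n v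
      have h2 := kernelDiag_pos (a := a) (b := b) hα (n + 1) v
      rw [Complex.conj_ofReal, ← mul_assoc, ← pow_two]
      exact_mod_cast inv_sqrt_sq_mul (mul_pos h1 h2)
    · simp

theorem isBergmanSystem_christoffelMeasure_iff {a b α : ℝ} (hb : 0 < b) (hab : b < a)
    (hα : -1 < α) (v : ℂ) (P : ℕ → ℂ[X]) :
    IsBergmanSystem (christoffelMeasure a b α v) P ↔ P = christoffelPoly a b α v := by
  have hν := integrable_christoffelMeasure_form hb hab hα v
  have h0 := christoffelPoly_isBergmanSystem hb hab hα v
  constructor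
  · intro h
    exact (h.isOrthonormalSystem hν).unique (h0.isOrthonormalSystem hν) h.leadingCoeff_pos
      h0.leadingCoeff_pos
  · rintro rfl
    exact h0

theorem christoffelCoeff_eq {a b α : ℝ} (hb : 0 < b) (hab : b < a) (hα : -1 < α) (v : ℂ) {l n : ℕ}
    (hln : l + 2 ≤ n) : christoffelCoeff a b α v l n =
      ((christoffelScale a b α v n * christoffelScale a b α v l : ℝ) : ℂ) *
        ((gegenbauerON a b α (n + 1)).eval v * recurrenceDefect a b α l v (conj v)) := by
  rw [christoffelCoeff, fourierCoeff_eq (integrable_christoffelMeasure_form hb hab hα v),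
    measureForm_christoffelMeasure hb hab hα, mul_left_comm, sub_mul_christoffelPoly,
    sub_mul_christoffelPoly, mul_left_comm, form_C_mul_left, form_C_mul_right,
    form_X_mul_christoffelNumerator hb hab hα (gegenbauerON_isOrthonormalSystem hb hab hα) hln,
    Complex.conj_ofReal, Complex.ofReal_mul, christoffelScale, christoffelScale]
  ring

theorem christoffelCoeff_eq_zero_iff {a b α : ℝ} (hb : 0 < b) (hab : b < a) (hα : -1 < α) (v : ℂ)
    {l n : ℕ} (hln : l + 2 ≤ n) : christoffelCoeff a b α v l n = 0 ↔
      (gegenbauerON a b α (n + 1)).eval v = 0 ∨ recurrenceDefect a b α l v (conj v) = 0 := by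
  have h1 := christoffelScale_pos (a := a) (b := b) hα v n
  have h2 := christoffelScale_pos (a := a) (b := b) hα v l
  have h3 : ((christoffelScale a b α v n * christoffelScale a b α v l : ℝ) : ℂ) ≠ 0 :=
    Complex.ofReal_ne_zero.2 (by positivity)
  rw [christoffelCoeff_eq hb hab hα v hln, mul_eq_zero, or_iff_right h3, mul_eq_zero]

/-! ### A reversed Turán inequality -/

/-- Here `t` is the larger root of `r + 1/r = 2x`, and `r + 1/r < 2x` strictly between the roots.
The recurrence keeps `r n` below `t`; subtracting two consecutive instances of it turns this
inequality and the growth already known into the next growth step. -/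
theorem ratio_strictMono {lam t x : ℝ} (hl : 0 < lam) (ht : 1 < t) (hx : t + 1 / t = 2 * x)
    {r : ℕ → ℝ} (h0 : r 0 = x)
    (hr : ∀ n : ℕ, (n + 1 + 2 * lam) * r (n + 1) = 2 * (n + 1 + lam) * x - (n + 1) / r n) (n : ℕ) :
    x ≤ r n ∧ r n < t ∧ r n < r (n + 1) := by
  have ht0 : 0 < t := by linarith
  have hti : 1 / t < 1 := (div_lt_one ht0).2 ht
  have hx1 : 1 < x := by
    have h1 : t * (1 / t) = 1 := by field_simp
    nlinarith [mul_pos (sub_pos.2 ht) (sub_pos.2 ht)]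
  have hxt : x < t := by linarith
  induction n with
  | zero =>
    refine ⟨h0.ge, h0.trans_lt hxt, ?_⟩
    have h := hr 0
    rw [h0] at h ⊢
    simp only [Nat.cast_zero, zero_add] at h
    have h2 : 1 / x < x := by rw [div_lt_iff₀ (by linarith)]; nlinarith
    nlinarith
  | succ n ih =>
    obtain ⟨h1, h2, h3⟩ := ih
    have hpos : 0 < r n := by linarith
    have hpos' : 0 < r (n + 1) := by linarith
    have hn : (0 : ℝ) < n + 1 + 2 * lam := by positivity
    have hrn := hr n
    have hlt : r (n + 1) < t := by
      have h4 : ((n : ℝ) + 1) / t < (n + 1) / r n :=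
        div_lt_div_of_pos_left (by positivity) hpos h2
      have h5 : ((n : ℝ) + 1) / t = (n + 1) * (1 / t) := by ring
      -- Replacing `r n` by `t` in the recurrence gives the bound `(n + 1 + lam) t + lam / t`, and
      -- `1 / t < t`.
      have h6 : (n + 1 + 2 * lam) * r (n + 1) < (n + 1 + 2 * lam) * t := by
        rw [hrn]
        nlinarith
      exact lt_of_mul_lt_mul_left h6 hn.le
    refine ⟨by linarith, hlt, ?_⟩
    have hrn1 := hr (n + 1)
    push_cast at hrn1
    have h4 : ((n : ℝ) + 1) / r (n + 1) ≤ (n + 1) / r n :=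
      div_le_div_of_nonneg_left (by positivity) hpos h3.le
    have h5 : ((n : ℝ) + 1 + 1) / r (n + 1) = (n + 1) / r (n + 1) + 1 / r (n + 1) := by ring
    have h6 : r (n + 1) + 1 / r (n + 1) < 2 * x := by
      have h7 : 0 < (t - r (n + 1)) * (r (n + 1) - 1 / t) :=
        mul_pos (by linarith) (by linarith)
      have h8 : (t - r (n + 1)) * (r (n + 1) - 1 / t) = 2 * x * r (n + 1) - r (n + 1) ^ 2 - 1 := by
        rw [← hx]; field_simp; ring
      have h9 : r (n + 1) + 1 / r (n + 1) = (r (n + 1) ^ 2 + 1) / r (n + 1) := by field_simp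
      rw [h9, div_lt_iff₀ hpos']
      linarith
    have hn' : (0 : ℝ) < n + 1 + 1 + 2 * lam := by positivity
    refine lt_of_mul_lt_mul_left ?_ hn'.le
    rw [hrn1]
    linarith

/-- In terms of `C_n(x) / C_n(1)` this is strict log-convexity in `n`, opposite to Turán's
inequality on `[-1, 1]`. The sequence `r` below consists of the quotients of consecutive normalised
values, so its monotonicity is the claim. -/
theorem gegenbauer_turan {lam t x : ℝ} (hl : 0 < lam) (ht : 1 < t) (hx : t + 1 / t = 2 * x)
    (hpos : ∀ n, 0 < (gegenbauer lam n).eval x) (n : ℕ) :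
    (n + 1) * (n + 1 + 2 * lam) * (gegenbauer lam (n + 1)).eval x ^ 2 <
      (n + 2) * (n + 2 * lam) * (gegenbauer lam n).eval x * (gegenbauer lam (n + 2)).eval x := by
  have h := ratio_strictMono hl ht hx (r := fun n : ℕ =>
    (n + 1) * (gegenbauer lam (n + 1)).eval x / ((n + 2 * lam) * (gegenbauer lam n).eval x))
    (by simp [gegenbauer]; field_simp)
    (fun n => by
      have h0 := hpos n
      have h1 := hpos (n + 1)
      have hrec := gegenbauer_recurrence lam n x
      have : (0 : ℝ) < n + 1 + 2 * lam := by positivity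
      push_cast
      field_simp
      linarith) n
  have h2 := h.2.2
  have h0 := hpos n
  have h1 := hpos (n + 1)
  push_cast at h2
  rw [div_lt_div_iff₀ (by positivity) (by positivity)] at h2
  linarith

theorem ellipse_parameter {a b : ℝ} (hb : 0 < b) (hab : b < a) :
    1 < (a + b) / (a - b) ∧ (a + b) / (a - b) + 1 / ((a + b) / (a - b)) =
      2 * ((a ^ 2 + b ^ 2) / (a ^ 2 - b ^ 2)) := by
  have h1 : 0 < a - b := by linarith
  have h2 : 0 < a + b := by linarith
  have h3 : a ^ 2 - b ^ 2 = (a + b) * (a - b) := by ring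
  refine ⟨by rw [lt_div_iff₀ h1]; linarith, ?_⟩
  rw [h3]
  field_simp
  ring

theorem gegenbauer_eval_parameter_pos {a b lam : ℝ} (hb : 0 < b) (hab : b < a) (hl : 0 < lam)
    (n : ℕ) : 0 < (gegenbauer lam n).eval ((a ^ 2 + b ^ 2) / (a ^ 2 - b ^ 2)) := by
  have hab2 : 0 < a ^ 2 - b ^ 2 := by nlinarith
  refine gegenbauer_eval_pos hl (A := (a + b) / 2) (B := (a - b) / 2) (by linarith) (by linarith)
    ?_ n
  field_simp; ring

/-- Up to a positive factor, this expression is the difference of the two sides of the Turán-type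
inequality at index `l`, once the values `C_n` are written through the norms `h_n`. -/
theorem leadCoeffON_defect_ne_zero {a b α : ℝ} (hb : 0 < b) (hab : b < a) (hα : -1 < α) (l : ℕ) :
    leadCoeffON a b α (l + 1) ^ 2 * recDown a b α l
      - leadCoeffON a b α l * leadCoeffON a b α (l + 2) * recDown a b α (l + 1) ≠ 0 := by
  have hab2 : 0 < a ^ 2 - b ^ 2 := by nlinarith
  have hl : 0 < 1 + α := by linarith
  obtain ⟨ht, hx⟩ := ellipse_parameter hb hab
  have hturan := gegenbauer_turan hl ht hx (gegenbauer_eval_parameter_pos hb hab hl) l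
  have hh := gegenbauerNorm_pos hb hab hα
  have hC : ∀ n : ℕ, (gegenbauer (1 + α) n).eval ((a ^ 2 + b ^ 2) / (a ^ 2 - b ^ 2)) =
      (1 + α + n) / (1 + α) * √(gegenbauerNorm a b α n) ^ 2 := by
    intro n
    have : 1 + α + n ≠ 0 := by positivity
    rw [Real.sq_sqrt (hh n).le, gegenbauerNorm]
    field_simp
  have hg0 := Real.sqrt_pos.2 (hh l)
  have hg1 := Real.sqrt_pos.2 (hh (l + 1))
  have hg2 := Real.sqrt_pos.2 (hh (l + 2))
  have hc := Real.sqrt_pos.2 hab2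
  have hP := rising_pos hl l
  rw [hC, hC, hC] at hturan
  unfold leadCoeffON recDown
  rw [show rising (1 + α) (l + 2) = rising (1 + α) l * (1 + α + l) * (1 + α + (l + 1)) by
    rw [rising_succ, rising_succ]; push_cast; rfl, rising_succ,
    show (l + 2).factorial = (l + 2) * ((l + 1) * l.factorial) by
      rw [Nat.factorial_succ, Nat.factorial_succ], Nat.factorial_succ]
  have hf : (0 : ℝ) < l.factorial := by positivity
  have hl0 : 0 < 1 + α + l := by positivity
  have hl1 : 0 < (l : ℝ) + 1 + (1 + α) := by positivity
  have hl2 : 0 < (l : ℝ) + 1 + 1 + (1 + α) := by positivity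
  push_cast at hturan ⊢
  rw [show l + 1 + 1 = l + 2 by ring]
  have hm : (0 : ℝ) ≤ l := l.cast_nonneg
  have hd : 0 < (1 / √(a ^ 2 - b ^ 2)) ^ l := by positivity
  have h2 : (0 : ℝ) < 2 ^ l := by positivity
  simp only [pow_add, pow_one]
  generalize √(gegenbauerNorm a b α l) = g0 at *
  generalize √(gegenbauerNorm a b α (l + 1)) = g1 at *
  generalize √(gegenbauerNorm a b α (l + 2)) = g2 at *
  generalize √(a ^ 2 - b ^ 2) = c at *
  generalize rising (1 + α) l = P at *
  generalize (l.factorial : ℝ) = f at *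
  generalize (1 / c) ^ l = d at *
  generalize (2 : ℝ) ^ l = e at *
  generalize (l : ℝ) = m at *
  -- `T` will be the Turán difference; the explicit cofactor is manifestly positive.
  have key : ∀ E T : ℝ, 0 < T → E = (e * P / f * d) ^ 2 * (2 * (1 + α + m) * (1 + α) ^ 2 /
      (c * (m + 1) ^ 2 * (m + 2) * (m + 1 + (1 + α)) * (m + 1 + 1 + (1 + α)) *
        (g0 * g1 ^ 3 * g2 ^ 2))) * T → E ≠ 0 := by
    rintro E T hT rfl
    positivity
  refine key _ _ (sub_pos.2 hturan) ?_
  field_simp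
  ring

/-! ### The zero set of the recurrence defect -/

/-- `f` has degree at most `n`, and `k` is its coefficient of degree `n`. -/
def HasTop (f : ℂ[X]) (n : ℕ) (k : ℂ) : Prop := f.natDegree ≤ n ∧ f.coeff n = k

namespace HasTop

variable {f g : ℂ[X]} {n m : ℕ} {k k' : ℂ}

theorem mul (hf : HasTop f n k) (hg : HasTop g m k') : HasTop (f * g) (n + m) (k * k') :=
  ⟨natDegree_mul_le_of_le hf.1 hg.1, by
    rw [coeff_mul_add_eq_of_natDegree_le hf.1 hg.1, hf.2, hg.2]⟩

theorem add (hf : HasTop f n k) (hg : HasTop g n k') : HasTop (f + g) n (k + k') :=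
  ⟨natDegree_add_le_of_degree_le hf.1 hg.1, by rw [coeff_add, hf.2, hg.2]⟩

theorem sub (hf : HasTop f n k) (hg : HasTop g n k') : HasTop (f - g) n (k - k') :=
  ⟨(natDegree_sub_le_of_le hf.1 hg.1).trans (max_self n).le, by rw [coeff_sub, hf.2, hg.2]⟩

theorem C_mul (c : ℂ) (hf : HasTop f n k) : HasTop (C c * f) n (c * k) :=
  ⟨(natDegree_C_mul_le _ _).trans hf.1, by rw [coeff_C_mul, hf.2]⟩

theorem of_lt (hf : f.natDegree < n) : HasTop f n 0 :=
  ⟨hf.le, coeff_eq_zero_of_natDegree_lt hf⟩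

theorem zero_of_lt (hf : HasTop f m k) (h : m < n) : HasTop f n 0 :=
  of_lt (hf.1.trans_lt h)

theorem sum_range_succ {f : ℕ → ℂ[X]} {l : ℕ} (h : ∀ j < l, (f j).natDegree < n)
    (hl : HasTop (f l) n k) : HasTop (∑ j ∈ Finset.range (l + 1), f j) n k := by
  rw [Finset.sum_range_succ]
  have h0 : HasTop (∑ j ∈ Finset.range l, f j) n 0 := by
    refine ⟨natDegree_sum_le_of_forall_le _ _ fun j hj => (h j (Finset.mem_range.1 hj)).le, ?_⟩
    rw [finsetSum_coeff]
    exact Finset.sum_eq_zero fun j hj =>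
      coeff_eq_zero_of_natDegree_lt (h j (Finset.mem_range.1 hj))
  simpa using h0.add hl

theorem comp_X_add_C (hf : HasTop f n k) (c : ℂ) : HasTop (f.comp (X + C c)) n k := by
  refine ⟨by rw [natDegree_comp, natDegree_X_add_C, mul_one]; exact hf.1, ?_⟩
  rcases hf.1.lt_or_eq with h | h
  · rw [← hf.2, coeff_eq_zero_of_natDegree_lt h, coeff_eq_zero_of_natDegree_lt]
    rwa [natDegree_comp, natDegree_X_add_C, mul_one]
  · have h1 : (f.comp (X + C c)).natDegree = n := by
      rw [natDegree_comp, natDegree_X_add_C, mul_one, h]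
    have h2 := leadingCoeff_comp (p := f) (q := X + C c) (by rw [natDegree_X_add_C]; simp)
    rw [leadingCoeff_X_add_C, one_pow, mul_one, leadingCoeff, leadingCoeff, h1, h, hf.2] at h2
    exact h2

end HasTop

/-- The polynomial `p_j(X + c)`. -/
def shiftedON (a b α : ℝ) (c : ℂ) (j : ℕ) : ℂ[X] := (gegenbauerON a b α j).comp (X + C c)

/-- The polynomial `x ↦ transferCoeff (x + c) j`. -/
def shiftedTransfer (a b α : ℝ) (c : ℂ) : ℕ → ℂ[X]
  | 0 => C (recDown a b α 0 : ℂ) * shiftedON a b α c 1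
  | j + 1 => C (recUp a b α j : ℂ) * shiftedON a b α c j +
      C (recDown a b α (j + 1) : ℂ) * shiftedON a b α c (j + 2)

/-- The polynomial `x ↦ recurrenceDefect l (x + c) (x + d)`. -/
def shiftedDefect (a b α : ℝ) (l : ℕ) (c d : ℂ) : ℂ[X] :=
  shiftedON a b α d (l + 1) *
      ∑ j ∈ Finset.range (l + 1), shiftedON a b α c j * shiftedTransfer a b α d j
    - (∑ j ∈ Finset.range (l + 1), shiftedON a b α c j * shiftedON a b α d j) *
        shiftedTransfer a b α d (l + 1)

theorem shiftedON_eval (a b α : ℝ) (c : ℂ) (j : ℕ) (x : ℂ) :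
    (shiftedON a b α c j).eval x = (gegenbauerON a b α j).eval (x + c) := by
  simp [shiftedON]

theorem shiftedTransfer_eval (a b α : ℝ) (c : ℂ) (j : ℕ) (x : ℂ) :
    (shiftedTransfer a b α c j).eval x = transferCoeff a b α (x + c) j := by
  cases j <;> simp [shiftedTransfer, transferCoeff, shiftedON_eval]

theorem shiftedDefect_eval (a b α : ℝ) (l : ℕ) (c d x : ℂ) :
    (shiftedDefect a b α l c d).eval x = recurrenceDefect a b α l (x + c) (x + d) := by
  simp only [shiftedDefect, recurrenceDefect, eval_sub, eval_mul, eval_finsetSum, shiftedON_eval,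
    shiftedTransfer_eval]

theorem shiftedON_hasTop {a b α : ℝ} (hb : 0 < b) (hab : b < a) (hα : -1 < α) (c : ℂ) (j : ℕ) :
    HasTop (shiftedON a b α c j) j (leadCoeffON a b α j) := by
  obtain ⟨h1, h2⟩ := gegenbauerON_natDegree hb hab hα j
  exact HasTop.comp_X_add_C ⟨h1.le, h2⟩ c

theorem shiftedTransfer_hasTop {a b α : ℝ} (hb : 0 < b) (hab : b < a) (hα : -1 < α) (c : ℂ)
    (j : ℕ) : HasTop (shiftedTransfer a b α c j) (j + 1)
      (recDown a b α j * leadCoeffON a b α (j + 1)) := by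
  cases j with
  | zero => exact (shiftedON_hasTop hb hab hα c 1).C_mul _
  | succ j =>
    have h := (((shiftedON_hasTop hb hab hα c j).C_mul (recUp a b α j)).zero_of_lt
      (show j < j + 2 by omega)).add
        ((shiftedON_hasTop hb hab hα c (j + 2)).C_mul (recDown a b α (j + 1)))
    rwa [zero_add] at h

/-- In each sum only `j = l` reaches the maximal degree, so both products have formal degree `3l +
2`. The difference of their top coefficients is the leading coefficient of `p_l` times the quantity
of `leadCoeffON_defect_ne_zero`. -/
theorem shiftedDefect_ne_zero {a b α : ℝ} (hb : 0 < b) (hab : b < a) (hα : -1 < α) (l : ℕ)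
    (c d : ℂ) : shiftedDefect a b α l c d ≠ 0 := by
  have hp := shiftedON_hasTop hb hab hα
  have ht := shiftedTransfer_hasTop hb hab hα d
  have h1 := (hp d (l + 1)).mul (HasTop.sum_range_succ (l := l) (n := l + (l + 1))
    (fun j hj => (((hp c j).mul (ht j)).1).trans_lt (by omega)) ((hp c l).mul (ht l)))
  have h2 := (HasTop.sum_range_succ (l := l) (n := l + l)
    (fun j hj => (((hp c j).mul (hp d j)).1).trans_lt (by omega))
      ((hp c l).mul (hp d l))).mul (ht (l + 1))
  rw [show l + 1 + (l + (l + 1)) = 3 * l + 2 by ring] at h1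
  rw [show l + l + (l + 1 + 1) = 3 * l + 2 by ring] at h2
  have h3 := (h1.sub h2).2
  intro h0
  change (shiftedDefect a b α l c d).coeff _ = _ at h3
  rw [h0, coeff_zero] at h3
  have hne := leadCoeffON_defect_ne_zero hb hab hα l
  have hk := leadCoeffON_pos hb hab hα l
  refine mul_ne_zero hk.ne' hne ?_
  have h4 : ((leadCoeffON a b α l * (leadCoeffON a b α (l + 1) ^ 2 * recDown a b α l
      - leadCoeffON a b α l * leadCoeffON a b α (l + 2) * recDown a b α (l + 1)) : ℝ) : ℂ) = 0 := by
    push_cast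
    rw [show l + 1 + 1 = l + 2 by ring] at h3
    linear_combination -h3
  exact_mod_cast h4

theorem continuous_recurrenceDefect (a b α : ℝ) (l : ℕ) :
    Continuous fun v => recurrenceDefect a b α l v (conj v) := by
  have hp : ∀ j, Continuous fun v => (gegenbauerON a b α j).eval v := fun j =>
    (gegenbauerON a b α j).continuous
  have hq : ∀ j, Continuous fun v => (gegenbauerON a b α j).eval (conj v) := fun j =>
    (hp j).comp Complex.continuous_conj
  have ht : ∀ j, Continuous fun v => transferCoeff a b α (conj v) j := by
    intro j
    cases j with
    | zero => exact continuous_const.mul (hq 1)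
    | succ j => exact (continuous_const.mul (hq j)).add (continuous_const.mul (hq (j + 2)))
  unfold recurrenceDefect
  fun_prop

theorem isClosed_defect_zeros (a b α : ℝ) (l : ℕ) :
    IsClosed {v : ℂ | recurrenceDefect a b α l v (conj v) = 0} :=
  isClosed_eq (continuous_recurrenceDefect a b α l) continuous_const

/-- For fixed `y = Im v`, both `v = x + iy` and `conj v = x - iy` are shifts of the real variable
`x`. The section of the zero set thus lies among the roots of one nonzero polynomial, and Fubini
applies. -/
theorem volume_defect_zeros {a b α : ℝ} (hb : 0 < b) (hab : b < a) (hα : -1 < α) (l : ℕ) :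
    volume {v : ℂ | recurrenceDefect a b α l v (conj v) = 0} = 0 := by
  have hm := (isClosed_defect_zeros a b α l).measurableSet
  rw [← Complex.volume_preserving_equiv_real_prod.symm.measure_preimage hm.nullMeasurableSet,
    Measure.volume_eq_prod, Measure.prod_apply_symm
      (Complex.measurableEquivRealProd.symm.measurable hm)]
  refine lintegral_eq_zero_of_ae_eq_zero (Filter.Eventually.of_forall fun y => ?_)
  refine Set.Finite.measure_zero ?_ _
  have hfin : {x : ℂ | (shiftedDefect a b α l (y * Complex.I) (-(y * Complex.I))).IsRoot x}.Finite :=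
    finite_setOfPred_isRoot (shiftedDefect_ne_zero hb hab hα l _ _)
  refine (hfin.preimage (f := ((↑) : ℝ → ℂ)) Complex.ofReal_injective.injOn).subset fun x hx => ?_
  have hz : Complex.measurableEquivRealProd.symm (x, y) = x + y * Complex.I := by
    apply Complex.ext <;> simp
  have hx' : recurrenceDefect a b α l (Complex.measurableEquivRealProd.symm (x, y))
    (conj (Complex.measurableEquivRealProd.symm (x, y))) = 0 := hx
  rw [hz] at hx'
  change (shiftedDefect a b α l (y * Complex.I) (-(y * Complex.I))).eval (x : ℂ) = 0
  rw [shiftedDefect_eval, ← hx']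
  congr 1
  simp

/-! ### The first defect -/

theorem one_lt_parameter {a b : ℝ} (hb : 0 < b) (hab : b < a) :
    1 < (a ^ 2 + b ^ 2) / (a ^ 2 - b ^ 2) := by
  have hab2 : 0 < a ^ 2 - b ^ 2 := by nlinarith
  rw [one_lt_div hab2]
  nlinarith

theorem gegenbauerON_one_eval {a b α : ℝ} (w : ℂ) :
    (gegenbauerON a b α 1).eval w = ((2 * (1 + α) / √(a ^ 2 - b ^ 2) /
      √(gegenbauerNorm a b α 1) : ℝ) : ℂ) * w := by
  rw [gegenbauerON_eq, scaledGegenbauer_one]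
  simp only [eval_mul, eval_C, eval_X]
  push_cast
  ring

theorem gegenbauerON_two_eval {a b α : ℝ} (w : ℂ) :
    (gegenbauerON a b α 2).eval w =
      ((2 * (1 + α) * (2 + α) / √(a ^ 2 - b ^ 2) ^ 2 / √(gegenbauerNorm a b α 2) : ℝ) : ℂ) * w ^ 2
        - (((1 + α) / √(gegenbauerNorm a b α 2) : ℝ) : ℂ) := by
  have h := congrArg (eval w) (scaledGegenbauer_recurrence (1 + α) (1 / √(a ^ 2 - b ^ 2)) 0)
  rw [zero_add, zero_add, scaledGegenbauer_one, scaledGegenbauer_zero] at h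
  simp only [eval_sub, eval_mul, eval_C, eval_X, eval_one] at h
  rw [gegenbauerON_eq]
  simp only [eval_mul, eval_C]
  push_cast at h ⊢
  linear_combination (1 / (√(gegenbauerNorm a b α 2) : ℂ)) / 2 * h

/-- Since `p_0 = 1`, nothing depends on `z`, and the defect is an even quadratic in `w`. Inserting
the explicit `h_1`, `h_2` identifies its roots. -/
theorem recurrenceDefect_zero {a b α : ℝ} (hb : 0 < b) (hab : b < a) (hα : -1 < α) :
    ∃ K : ℝ, K ≠ 0 ∧ ∀ z w : ℂ, recurrenceDefect a b α 0 z w =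
      K * (w ^ 2 - (((a ^ 2 + b ^ 2) / √(a ^ 2 - b ^ 2) : ℝ) : ℂ) ^ 2) := by
  have hab2 : 0 < a ^ 2 - b ^ 2 := by nlinarith
  have hl : 0 < 1 + α := by linarith
  have hl2 : 0 < 2 + α := by linarith
  have hx := one_lt_parameter hb hab
  have hh1 := gegenbauerNorm_pos hb hab hα 1
  have hh2 := gegenbauerNorm_pos hb hab hα 2
  have hc := Real.sqrt_pos.2 hab2
  have hcx : (a ^ 2 + b ^ 2) / √(a ^ 2 - b ^ 2) =
      √(a ^ 2 - b ^ 2) * ((a ^ 2 + b ^ 2) / (a ^ 2 - b ^ 2)) := by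
    nth_rewrite 3 [← Real.sq_sqrt hab2.le]
    field_simp
  have e0 : gegenbauerNorm a b α 0 = 1 := by
    simp [gegenbauerNorm, gegenbauer, hl.ne']
  have e1 : √(gegenbauerNorm a b α 1) ^ 2 =
      2 * (1 + α) ^ 2 / (2 + α) * ((a ^ 2 + b ^ 2) / (a ^ 2 - b ^ 2)) := by
    rw [Real.sq_sqrt hh1.le, gegenbauerNorm]
    simp only [gegenbauer, eval_mul, eval_C, eval_X]
    rw [show 1 + α + ((1 : ℕ) : ℝ) = 2 + α by push_cast; ring]
    generalize (a ^ 2 + b ^ 2) / (a ^ 2 - b ^ 2) = x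
    field_simp
  have e2 : (3 + α) * √(gegenbauerNorm a b α 2) ^ 2 =
      (1 + α) ^ 2 * (2 * (2 + α) * ((a ^ 2 + b ^ 2) / (a ^ 2 - b ^ 2)) ^ 2 - 1) := by
    rw [Real.sq_sqrt hh2.le, gegenbauerNorm]
    simp only [gegenbauer, eval_mul, eval_C, eval_X, eval_sub, eval_one]
    rw [show 1 + α + ((2 : ℕ) : ℝ) = 3 + α by push_cast; ring]
    have h3 : 3 + α ≠ 0 := by linarith
    generalize (a ^ 2 + b ^ 2) / (a ^ 2 - b ^ 2) = x
    push_cast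
    field_simp
    ring
  have hg1 := Real.sqrt_pos.2 hh1
  have hg2 := Real.sqrt_pos.2 hh2
  have hD : ∀ z w : ℂ, recurrenceDefect a b α 0 z w =
      recDown a b α 0 * (gegenbauerON a b α 1).eval w ^ 2 - recUp a b α 0
        - recDown a b α 1 * (gegenbauerON a b α 2).eval w := by
    intro z w
    simp only [recurrenceDefect, transferCoeff, zero_add, Finset.sum_range_one,
      gegenbauerON_zero hα, eval_one]
    ring
  simp_rw [hD, gegenbauerON_one_eval, gegenbauerON_two_eval, hcx]
  simp only [recDown, recUp, e0, Nat.cast_zero, Nat.cast_one, zero_add, Real.sqrt_one]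
  generalize (a ^ 2 + b ^ 2) / (a ^ 2 - b ^ 2) = x at *
  generalize √(gegenbauerNorm a b α 1) = g1 at *
  generalize √(gegenbauerNorm a b α 2) = g2 at *
  generalize √(a ^ 2 - b ^ 2) = c at *
  have hM : 0 < 2 * (2 + α) * x ^ 2 - 1 := by nlinarith
  have h3 : 0 < 3 + α := by linarith
  have hx0 : 0 < x := by linarith
  have hx21 : 0 < x ^ 2 - 1 := by nlinarith
  -- The defect is `P w² - Q`. It remains to see that `P ≠ 0`, where `x > 1` enters, and that `Q = P
  -- (c x)²`.
  set P : ℝ := 2 * (1 + α) * c / (2 * (1 + (1 + α))) * (1 / g1) *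
    (2 * (1 + α) / c / g1) ^ 2 - (1 + 2 * (1 + α)) * c / (2 * (1 + 1 + (1 + α))) * (g1 / g2) *
      (2 * (1 + α) * (2 + α) / c ^ 2 / g2) with hP
  set Q : ℝ := 1 * c / (2 * (1 + α)) * (g1 / 1) -
    (1 + 2 * (1 + α)) * c / (2 * (1 + 1 + (1 + α))) * (g1 / g2) * ((1 + α) / g2) with hQ
  have eg2 : g2 ^ 2 = (1 + α) ^ 2 * (2 * (2 + α) * x ^ 2 - 1) / (3 + α) := by
    rw [eq_div_iff h3.ne', ← e2]; ring
  have eg1 : g1 ^ 4 = (2 * (1 + α) ^ 2 / (2 + α) * x) ^ 2 := by rw [← e1]; ring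
  have hP1 : P = 4 * (1 + α) ^ 3 / ((2 + α) * c * g1 ^ 3)
      - (3 + 2 * α) * (1 + α) * (2 + α) / (c * (3 + α)) * (g1 / g2 ^ 2) := by
    rw [hP, show 1 + (1 + α) = 2 + α by ring, show 1 + 1 + (1 + α) = 3 + α by ring]
    field_simp
    ring
  have hQ1 : Q = c * g1 / (2 * (1 + α))
      - (3 + 2 * α) * (1 + α) * c / (2 * (3 + α)) * (g1 / g2 ^ 2) := by
    rw [hQ, show 1 + 1 + (1 + α) = 3 + α by ring]
    field_simp
    ring
  rw [eg2] at hP1 hQ1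
  have hP' : P * (c * g1 ^ 3) * (2 * (2 + α) * x ^ 2 - 1) =
      4 * (1 + α) ^ 3 / (2 + α) * (x ^ 2 - 1) := by
    have h : P * (c * g1 ^ 3) * (2 * (2 + α) * x ^ 2 - 1) =
        4 * (1 + α) ^ 3 / (2 + α) * (2 * (2 + α) * x ^ 2 - 1)
          - (3 + 2 * α) * (2 + α) / (1 + α) * g1 ^ 4 := by
      rw [hP1]
      field_simp
    rw [h, eg1]
    field_simp
    ring
  have hQ' : Q = P * (c * x) ^ 2 := by
    have h : Q * (g1 ^ 3 * (2 * (2 + α) * x ^ 2 - 1)) =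
        c / (2 * (1 + α)) * (2 * (2 + α) * x ^ 2 - 1 - (3 + 2 * α)) * g1 ^ 4 := by
      rw [hQ1]
      field_simp
    have hne : g1 ^ 3 * (2 * (2 + α) * x ^ 2 - 1) ≠ 0 := by positivity
    rw [← mul_left_inj' hne, h, eg1]
    have h' : P * (c * x) ^ 2 * (g1 ^ 3 * (2 * (2 + α) * x ^ 2 - 1)) =
        c * x ^ 2 * (P * (c * g1 ^ 3) * (2 * (2 + α) * x ^ 2 - 1)) := by ring
    rw [h', hP']
    field_simp
    ring
  refine ⟨P, ?_, fun z w => ?_⟩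
  · intro h0
    rw [h0, zero_mul, zero_mul] at hP'
    have : 0 < 4 * (1 + α) ^ 3 / (2 + α) * (x ^ 2 - 1) := by positivity
    linarith
  · have hQc : (Q : ℂ) = P * ((c * x : ℝ) : ℂ) ^ 2 := by rw [hQ']; push_cast; ring
    rw [mul_sub (P : ℂ), ← hQc, hP, hQ]
    push_cast
    ring

/-! ### Vanishing of the Fourier coefficients -/

theorem recDown_pos {a b α : ℝ} (hb : 0 < b) (hab : b < a) (hα : -1 < α) (n : ℕ) :
    0 < recDown a b α n := by
  have hab2 : 0 < a ^ 2 - b ^ 2 := by nlinarith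
  have hl : 0 < 1 + α := by linarith
  have h0 := gegenbauerNorm_pos hb hab hα n
  have h1 := gegenbauerNorm_pos hb hab hα (n + 1)
  unfold recDown
  positivity

/-- The coefficient of `p_n` in `z p_{n+1}` is nonzero, so two consecutive zeros propagate downwards
to `p_0 = 1`. -/
theorem gegenbauerON_no_common_zero {a b α : ℝ} (hb : 0 < b) (hab : b < a) (hα : -1 < α) (v : ℂ)
    (n : ℕ) : ¬ ((gegenbauerON a b α n).eval v = 0 ∧ (gegenbauerON a b α (n + 1)).eval v = 0) := by
  induction n with
  | zero => simp [gegenbauerON_zero hα]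
  | succ n ih =>
    rintro ⟨h1, h2⟩
    refine ih ⟨?_, h1⟩
    have h := congrArg (eval v) (X_mul_gegenbauerON_succ hb hab hα n)
    simp only [eval_add, eval_mul, eval_C, eval_X, h1, mul_zero] at h
    rw [show n + 1 + 1 = n + 2 by ring] at h2
    rw [h2, mul_zero, zero_add] at h
    have hd : (recDown a b α n : ℂ) ≠ 0 := Complex.ofReal_ne_zero.2 (recDown_pos hb hab hα n).ne'
    exact (mul_eq_zero.1 h.symm).resolve_left hd

theorem christoffelCoeff_zeros {a b α : ℝ} (hb : 0 < b) (hab : b < a) (hα : -1 < α) {l n : ℕ}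
    (hln : l + 2 ≤ n) : IsClosed {v : ℂ | christoffelCoeff a b α v l n = 0} ∧
      volume {v : ℂ | christoffelCoeff a b α v l n = 0} = 0 := by
  have hS : {v : ℂ | christoffelCoeff a b α v l n = 0} =
      {v : ℂ | (gegenbauerON a b α (n + 1)).IsRoot v} ∪
        {v : ℂ | recurrenceDefect a b α l v (conj v) = 0} := by
    ext v
    exact christoffelCoeff_eq_zero_iff hb hab hα v hln
  have hfin : {v : ℂ | (gegenbauerON a b α (n + 1)).IsRoot v}.Finite :=
    finite_setOfPred_isRoot ((gegenbauerON_isOrthonormalSystem hb hab hα).ne_zero (n + 1))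
  rw [hS]
  exact ⟨hfin.isClosed.union (isClosed_defect_zeros a b α l),
    measure_union_null (hfin.measure_zero _) (volume_defect_zeros hb hab hα l)⟩

theorem not_hasFiniteTermRecurrence {a b α : ℝ} (hb : 0 < b) (hab : b < a) (hα : -1 < α) {v : ℂ}
    (hv : v ≠ (((a ^ 2 + b ^ 2) / √(a ^ 2 - b ^ 2) : ℝ) : ℂ))
    (hv' : v ≠ ((-((a ^ 2 + b ^ 2) / √(a ^ 2 - b ^ 2)) : ℝ) : ℂ)) :
    ¬ HasFiniteTermRecurrence (christoffelMeasure a b α v) (christoffelPoly a b α v) := by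
  rintro ⟨d, -, h⟩
  have hdef : recurrenceDefect a b α 0 v (conj v) ≠ 0 := by
    obtain ⟨K, hK, hD⟩ := recurrenceDefect_zero hb hab hα
    rw [hD]
    refine mul_ne_zero (Complex.ofReal_ne_zero.2 hK) fun h0 => ?_
    -- The defect vanishes according to `conj v`; the exceptional points are real, so the condition
    -- is the same for `v`.
    rcases sq_eq_sq_iff_eq_or_eq_neg.1 (sub_eq_zero.1 h0) with h1 | h1
    · exact hv (by rw [← Complex.conj_conj v, h1, Complex.conj_ofReal])
    · refine hv' ?_
      rw [← Complex.conj_conj v, h1, map_neg, Complex.conj_ofReal, Complex.ofReal_neg]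
  -- The column `l = 0` suffices: `n ≥ d + 2` lies outside the band and also ensures `n ≥ 2`, as the
  -- factorisation requires.
  have hroot : ∀ n, d + 2 ≤ n → (gegenbauerON a b α (n + 1)).eval v = 0 := fun n hn =>
    ((christoffelCoeff_eq_zero_iff hb hab hα v (l := 0) (by omega)).1
      (h 0 n (by omega))).resolve_right hdef
  exact gegenbauerON_no_common_zero hb hab hα v (d + 3)
    ⟨hroot (d + 2) le_rfl, hroot (d + 3) (by omega)⟩

theorem exists_weight_not_hasFiniteTermRecurrence {a b α : ℝ} (hb : 0 < b) (hab : b < a)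
    (hα : -1 < α) : ∃ w : ℂ → ℝ, ContinuousOn w (ellipse a b) ∧ (∀ z ∈ ellipse a b, 0 < w z) ∧
      (∀ k l : ℕ, IntegrableOn (fun z : ℂ => z ^ k * conj z ^ l * (w z : ℂ)) (ellipse a b)) ∧
      ∃ P : ℕ → ℂ[X], IsBergmanSystem (weightedArea (ellipse a b) w) P ∧
        ¬ HasFiniteTermRecurrence (weightedArea (ellipse a b) w) P := by
  have ha := hb.trans hab
  -- The point `2bi` lies outside the ellipse, so `|v - z|²` is positive on it, and it is not real,
  -- so it avoids both exceptional points.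
  set v : ℂ := ⟨0, 2 * b⟩ with hv
  have hvE : v ∉ ellipse a b := by
    intro h
    have h' : (0 : ℝ) ^ 2 / a ^ 2 + (2 * b) ^ 2 / b ^ 2 < 1 := h
    rw [mul_pow, mul_div_cancel_right₀ _ (by positivity)] at h'
    norm_num at h'
  have hreal : ∀ r : ℝ, v ≠ (r : ℂ) := by
    intro r h
    have := congrArg Complex.im h
    simp [hv] at this
    linarith
  refine ⟨fun z => ‖v - z‖ ^ 2 * gegenbauerWeight a b α z, ?_, fun z hz => ?_, fun k l => ?_,
    christoffelPoly a b α v, christoffelPoly_isBergmanSystem hb hab hα v,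
    not_hasFiniteTermRecurrence hb hab hα (hreal _) (hreal _)⟩
  · refine ContinuousOn.mul (by fun_prop) ?_
    unfold gegenbauerWeight
    refine (continuousOn_const.mul (ContinuousOn.rpow_const ?_ fun z hz => Or.inl ?_)).div_const _
    · exact (continuous_const.sub (continuous_ellipseForm a b)).continuousOn
    · exact (sub_pos.2 hz).ne'
  · have h1 := gegenbauerWeight_pos ha hb hα hz
    have h2 : 0 < ‖v - z‖ := norm_pos_iff.2 (sub_ne_zero.2 fun h => hvE (h ▸ hz))
    positivity
  · have hc : Continuous (conj : ℂ → ℂ) := Complex.continuous_conj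
    have h := integrableOn_christoffelWeight_smul hb hab hα v
      (F := fun z => z ^ k * conj z ^ l) (by fun_prop)
    refine h.congr_fun (fun z _ => ?_) (isOpen_ellipse a b).measurableSet
    simp only [Complex.real_smul, mul_comm]

end WeightedEllipse

end

theorem mainTheorem7 (a b α : ℝ) (hb : 0 < b) (hab : b < a) (hα : -1 < α) :
    -- the polynomials of the Christoffel-type formula are the Bergman polynomials
    (∀ v : ℂ, ∀ P : ℕ → ℂ[X],
      WeightedEllipse.IsBergmanSystem (WeightedEllipse.christoffelMeasure a b α v) P ↔
        P = WeightedEllipse.christoffelPoly a b α v) ∧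
    -- the expansion of multiplication by `z`
    (∀ (v : ℂ) (n : ℕ), X * WeightedEllipse.christoffelPoly a b α v n =
      ∑ l ∈ Finset.range (n + 2), C (WeightedEllipse.christoffelCoeff a b α v l n) *
        WeightedEllipse.christoffelPoly a b α v l) ∧
    -- no coefficient with `l ≤ n - 2` vanishes, except on a closed null set of parameters `v`
    (∀ l n : ℕ, l + 2 ≤ n →
      IsClosed {v : ℂ | WeightedEllipse.christoffelCoeff a b α v l n = 0} ∧
      volume {v : ℂ | WeightedEllipse.christoffelCoeff a b α v l n = 0} = 0) ∧
    -- hence, for almost every `v`, all of them are non-zero simultaneously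
    (∀ᵐ v : ℂ, ∀ l n : ℕ, l + 2 ≤ n → WeightedEllipse.christoffelCoeff a b α v l n ≠ 0) ∧
    -- no finite-term recurrence
    (∀ v : ℂ, v ≠ (((a ^ 2 + b ^ 2) / √(a ^ 2 - b ^ 2) : ℝ) : ℂ) →
      v ≠ ((-((a ^ 2 + b ^ 2) / √(a ^ 2 - b ^ 2)) : ℝ) : ℂ) →
      ¬ WeightedEllipse.HasFiniteTermRecurrence (WeightedEllipse.christoffelMeasure a b α v)
        (WeightedEllipse.christoffelPoly a b α v)) ∧
    -- so a weighted ellipse need not have a finite-term recurrence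
    (∃ w : ℂ → ℝ, ContinuousOn w (WeightedEllipse.ellipse a b) ∧
      (∀ z ∈ WeightedEllipse.ellipse a b, 0 < w z) ∧
      (∀ k l : ℕ, IntegrableOn (fun z : ℂ => z ^ k * conj z ^ l * (w z : ℂ))
        (WeightedEllipse.ellipse a b)) ∧
      ∃ P : ℕ → ℂ[X],
        WeightedEllipse.IsBergmanSystem
          (WeightedEllipse.weightedArea (WeightedEllipse.ellipse a b) w) P ∧
        ¬ WeightedEllipse.HasFiniteTermRecurrence
          (WeightedEllipse.weightedArea (WeightedEllipse.ellipse a b) w) P) := by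
  refine ⟨fun v P => WeightedEllipse.isBergmanSystem_christoffelMeasure_iff hb hab hα v P,
    fun v n => (WeightedEllipse.christoffelPoly_isBergmanSystem hb hab hα v).X_mul
      (WeightedEllipse.integrable_christoffelMeasure_form hb hab hα v) n,
    fun l n hln => WeightedEllipse.christoffelCoeff_zeros hb hab hα hln, ?_,
    fun v hv hv' => WeightedEllipse.not_hasFiniteTermRecurrence hb hab hα hv hv',
    WeightedEllipse.exists_weight_not_hasFiniteTermRecurrence hb hab hα⟩
  refine ae_all_iff.2 fun l => ae_all_iff.2 fun n => ?_
  by_cases hln : l + 2 ≤ n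
  · have h := measure_eq_zero_iff_ae_notMem.1
      (WeightedEllipse.christoffelCoeff_zeros hb hab hα hln).2
    filter_upwards [h] with v hv _ using hv
  · exact Filter.Eventually.of_forall fun v h => absurd h hln
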